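/- Let $(X,\mu)$ be a standard probability space and let $\mathcal R\subset X\times X$ be a nonsingular equivalence relation on it: $\mathcal R$ is measurable, has countable classes, and the $\mathcal R$-saturation of every $\mu$-null set is $\mu$-null. Sets and maps are identified when they agree up to null sets. Assume that $\mathcal R$ is ergodic (every $\mathcal R$-invariant function in $L^\infty(X)$ is a.e. constant). For a $\sigma$-finite measure $\nu$ equivalent to $\mu$, define measures on $\mathcal R$ by $\nu_\ell(W)=\int_X\#\{y:(x,y)\in W\}\,d\nu(x)$ and $\nu_r(W)=\int_X\#\{x:(x,y)\in W\}\,d\nu(y)$, and let $\delta_\nu=\frac{d\nu_\ell}{d\nu_r}$; $\nu$ is $\mathcal R$-invariant if $\nu_\ell=\nu_r$. Let $S(\mathcal R)\subset[0,\infty)$ be the intersection of the essential ranges of $\delta_\nu$ (in $[0,\infty)$) over all such $\nu$. Let $0<\lambda\le 1$ and assume that $\mathcal R$ is of type $\mathrm{III}_\lambda$: no equivalence class is conull, no $\sigma$-finite measure equivalent to $\mu$ is $\mathcal R$-invariant, and $S(\mathcal R)=\{0\}\cup\lambda^{\mathbf Z}$ if $\lambda<1$, $S(\mathcal R)=[0,\infty)$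 if $\lambda=1$. The full pseudo-group $[[\mathcal R]]$ is the set of nonsingular partial isomorphisms $\theta:\mathrm{dom}(\theta)\to\mathrm{ran}(\theta)$ between measurable subsets of $X$ with $(x,\theta(x))\in\mathcal R$ for a.e. $x\in\mathrm{dom}(\theta)$, and the full group $[\mathcal R]$ consists of those with $\mathrm{dom}(\theta)=\mathrm{ran}(\theta)=X$, with the topology of the metric $d_\mu(\theta,\theta')=\mu(\{x:\theta(x)\neq\theta'(x)\})$. An element $\theta\in[[\mathcal R]]$ is $\mu$-bounded if $\log\frac{d(\mu\circ\theta)}{d\mu}$ is essentially bounded on $\mathrm{dom}(\theta)$, where $(\mu\circ\theta)(E)=\mu(\theta(E\cap \mathrm{dom}(\theta)))$. Then: 1. For all measurable $A,B\subset X$ with $\mu(A)>0$ and $\mu(B)>0$, there is a $\mu$-bounded $\theta\in[[\mathcal R]]$ with $\mathrm{dom}(\theta)=A$ and $\mathrm{ran}(\theta)=B$. More precisely, for every $0<C<\lambda$ one can choose such a $\theta$ with $$C\,\frac{\mu(B)}{\mu(A)}\le\frac{d(\mu\circ\theta)}{d\mu}(x)\le C^{-1}\,\frac{\mu(B)}{\mu(A)}\qquad\text{for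 a.e. }x\in A.$$ 2. The $\mu$-bounded elements of $[\mathcal R]$ are dense in $[\mathcal R]$. -/

import Mathlib

open MeasureTheory Set

namespace NonsingularRelation

noncomputable section

variable {X : Type*} [MeasurableSpace X]

/-- The graph `{(x, y) | x ~ y}` of an equivalence relation, as a subset of `X × X`. -/
def graph (R : Setoid X) : Set (X × X) := {p | R p.1 p.2}

/-- The standing assumptions on an equivalence relation on a standard measure space:
measurable, with countable classes, and nonsingular. -/
structure IsNonsingular (R : Setoid X) (μ : Measure X) : Prop where
  measurableSet_graph : MeasurableSet (graph R)
  countable_class : ∀ x, {y | R x y}.Countable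
  saturation_null : ∀ N : Set X, μ N = 0 → μ {y | ∃ x ∈ N, R x y} = 0

/-- Ergodicity: every `R`-invariant function in `L^∞(X)` is constant. A property holds for
a.e. `(x, y) ∈ R` when its set of exceptions in `R` has null projection to `X`. -/
def IsErgodic (R : Setoid X) (μ : Measure X) : Prop :=
  ∀ f : X → ℂ, MemLp f ⊤ μ → (∀ᵐ x ∂μ, ∀ y, R x y → f x = f y) →
    ∃ c : ℂ, ∀ᵐ x ∂μ, f x = c

/-- `𝓜(X)`: the `σ`-finite measures in the measure class of `μ`. -/
def measureClass (μ : Measure X) : Set (Measure X) :=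
  {ν | SigmaFinite ν ∧ ν ≪ μ ∧ μ ≪ ν}

/-- The measure `μ_ℓ(W) = ∫ #{y | (x, y) ∈ W} dμ(x)` for `W ⊆ R`, viewed as a measure on `X × X`
that is concentrated on `R`. (The integrand is measurable in `x` because `R` is a measurable
subset of `X × X` with countable sections.) -/
def leftMeasure (R : Setoid X) (μ : Measure X) : Measure (X × X) :=
  μ.bind fun x => Measure.count.restrict {p | p ∈ graph R ∧ p.1 = x}

/-- The measure `μ_r(W) = ∫ #{x | (x, y) ∈ W} dμ(y)` for `W ⊆ R`, viewed as a measure on `X × X`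
that is concentrated on `R`. -/
def rightMeasure (R : Setoid X) (μ : Measure X) : Measure (X × X) :=
  μ.bind fun y => Measure.count.restrict {p | p ∈ graph R ∧ p.2 = y}

/-- `μ` is `R`-invariant if `μ_ℓ = μ_r`. -/
def IsInvariant (R : Setoid X) (μ : Measure X) : Prop :=
  leftMeasure R μ = rightMeasure R μ

/-- The modulus `δ_μ = dμ_ℓ / dμ_r`. -/
def modulus (R : Setoid X) (μ : Measure X) : X × X → ℝ :=
  fun p => ((leftMeasure R μ).rnDeriv (rightMeasure R μ) p).toReal

/-- The essential range of the modulus: the topological support of its push-forward measure. -/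
def essRangeModulus (R : Setoid X) (μ : Measure X) : Set ℝ :=
  ((rightMeasure R μ).map (modulus R μ)).support

/-- The invariant `S(R)`, the intersection of the essential ranges of `δ_ν` over all `σ`-finite
measures `ν` in the measure class of `μ`. -/
def SInvariant (R : Setoid X) (μ : Measure X) : Set ℝ :=
  ⋂ ν ∈ measureClass μ, essRangeModulus R ν

/-- Type I: only one equivalence class, up to measure zero. -/
def IsTypeI (R : Setoid X) (μ : Measure X) : Prop :=
  ∃ x, ∀ᵐ y ∂μ, R x y

/-- Type II₁. -/
def IsTypeII₁ (R : Setoid X) (μ : Measure X) : Prop :=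
  ¬ IsTypeI R μ ∧ ∃ ν ∈ measureClass μ, IsProbabilityMeasure ν ∧ IsInvariant R ν

/-- Type II_∞. -/
def IsTypeIIInf (R : Setoid X) (μ : Measure X) : Prop :=
  ¬ IsTypeI R μ ∧ ∃ ν ∈ measureClass μ, ν univ = ⊤ ∧ IsInvariant R ν

/-- Type III: neither of type I nor of type II. -/
def IsTypeIII (R : Setoid X) (μ : Measure X) : Prop :=
  ¬ IsTypeI R μ ∧ ¬ IsTypeII₁ R μ ∧ ¬ IsTypeIIInf R μ

/-- Type III_λ for `0 < λ ≤ 1`: the relation is of type III, and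
`S(R) = {0} ∪ λ^ℤ` if `λ < 1`, respectively `S(R) = [0, ∞)` if `λ = 1`. -/
def IsTypeIIIParam (R : Setoid X) (μ : Measure X) (l : ℝ) : Prop :=
  IsTypeIII R μ ∧
    ((0 < l ∧ l < 1 ∧ SInvariant R μ = {0} ∪ range (fun n : ℤ => l ^ n)) ∨
      (l = 1 ∧ SInvariant R μ = Ici 0))

/-- Nonsingular partial isomorphisms of `(X, μ)`: measurable bijections with measurable inverse
between measurable subsets, which preserve the null sets in both directions. -/
structure IsPartialIso (μ : Measure X) (θ : PartialEquiv X X) : Prop where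
  measurableSet_source : MeasurableSet θ.source
  measurableSet_target : MeasurableSet θ.target
  measurable_toFun : Measurable (θ.source.domRestrict θ)
  measurable_invFun : Measurable (θ.target.domRestrict θ.symm)
  null_iff : ∀ N, N ⊆ θ.source → (μ (θ '' N) = 0 ↔ μ N = 0)

/-- The full pseudo-group `[[R]]` (given by representatives modulo null sets). -/
def fullPseudogroup (R : Setoid X) (μ : Measure X) : Set (PartialEquiv X X) :=
  {θ | IsPartialIso μ θ ∧ ∀ᵐ x ∂μ, x ∈ θ.source → R x (θ x)}

/-- The measure `μ ∘ θ : E ↦ μ (θ (E ∩ dom θ))`. -/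
def compMeasure (μ : Measure X) (θ : PartialEquiv X X) : Measure X :=
  (μ.restrict θ.target).map θ.symm

/-- The Radon–Nikodym derivative `d(μ ∘ θ) / dμ`. -/
def derivative (μ : Measure X) (θ : PartialEquiv X X) : X → ℝ :=
  fun x => ((compMeasure μ θ).rnDeriv μ x).toReal

/-- A partial isomorphism `θ` is `μ`-bounded if `log (d(μ ∘ θ) / dμ)` is (essentially) bounded
on its domain. For a nonsingular `θ`, the derivative lies in `(0, ∞)` almost everywhere there. -/
def IsMuBounded (μ : Measure X) (θ : PartialEquiv X X) : Prop :=
  ∃ K : ℝ, ∀ᵐ x ∂μ, x ∈ θ.source → |Real.log (derivative μ θ x)| ≤ K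

/-- The full group `[R]`: the invertible elements of `[[R]]`, i.e. those whose domain and range
are conull (given by representatives modulo null sets). -/
def FullGroup (R : Setoid X) (μ : Measure X) : Type _ :=
  {θ : PartialEquiv X X //
    θ ∈ fullPseudogroup R μ ∧ θ.source =ᵐ[μ] univ ∧ θ.target =ᵐ[μ] univ}

/-- The topology of `[R]`, given by `d_μ(θ, θ') = μ {x | θ x ≠ θ' x}`. It is a pseudo-metric on
representatives, and the distance is zero exactly when the two define the same element of `[R]`. -/
instance (R : Setoid X) (μ : Measure X) [IsProbabilityMeasure μ] :
    PseudoMetricSpace (FullGroup R μ) where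
  dist θ θ' := μ.real {x | θ.1 x ≠ θ'.1 x}
  dist_self θ := by simp
  dist_comm θ θ' := by simp only [ne_comm]
  dist_triangle θ θ' θ'' := by
    refine (measureReal_mono (fun x hx => ?_)).trans (measureReal_union_le _ _)
    by_contra h
    simp only [mem_union, mem_ofPred_eq, not_or, not_not] at h
    exact hx (h.1.trans h.2)

end

end NonsingularRelation

/-!
Every ratio `t ∈ S(R)` is realized, up to a factor close to `1`, by a partial isomorphism inside
any nonnull set `A`: move `X` into `A` along `R` by a countable-to-one map, pull `μ` back along this
map, and conjugate a piece of `R` on which the modulus of the pulled-back measure is close to `t`.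
For type `III_λ` and `C < λ` some geometric progression `s^ℤ ⊆ S(R)` has `C < s < 1`. Composing
with a small partial isomorphism from `A` to `B`, whatever its ratio, one therefore
reaches every window `[C m, m]`.

For a prescribed mean ratio `m = μ(B) / μ(A)` take a maximal disjoint family of such pieces. With
ratios at most `m` it cannot exhaust `B` before `A`, so its domain is conull in `A`. Exchanging the
roles of `A` and `B` gives a family with conull range, and the Cantor–Bernstein argument combines
the two. For density, restrict an element of the full group to the set where its modulus is
bounded, and complete it by a bounded isomorphism between the two complements.
-/

namespace NonsingularRelation

section AnalyticSets

open Filter Topology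

variable {X : Type*} {f : (ℕ → ℕ) → X} {c : ENNReal}

theorem exists_forall_lt_measure_image_bounded [MeasurableSpace X] (μ : Measure X)
    (hc : c < μ (range f)) : ∃ n : ℕ → ℕ, ∀ k, c < μ (f '' {z | ∀ i < k, z i ≤ n i}) := by
  have exists_bound (k : ℕ) (U : {U : Set (ℕ → ℕ) // c < μ (f '' U)}) :
      ∃ m : ℕ, c < μ (f '' (U ∩ {z | z k ≤ m})) := by
    have hU : f '' U = ⋃ m : ℕ, f '' (U ∩ {z | z k ≤ m}) := by
      rw [← image_iUnion, ← inter_iUnion, iUnion_eq_univ_iff.2 fun z => ⟨z k, le_refl (z k)⟩,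
        inter_univ]
    have hmono : Monotone fun m : ℕ => f '' (U ∩ {z : ℕ → ℕ | z k ≤ m}) := fun _ _ h =>
      image_mono (inter_subset_inter_right _ fun _ hz => le_trans hz h)
    exact lt_iSup_iff.1 (hmono.measure_iUnion (μ := μ) ▸ hU ▸ U.2)
  choose m hm using exists_bound
  let U (k : ℕ) : {U : Set (ℕ → ℕ) // c < μ (f '' U)} :=
    Nat.rec ⟨univ, by rwa [image_univ]⟩ (fun k V => ⟨V ∩ {z | z k ≤ m k V}, hm k V⟩) k
  refine ⟨fun k => m k (U k), fun k => ?_⟩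
  suffices hU : (U k).1 = {z | ∀ i < k, z i ≤ m i (U i)} by
    rw [← hU]
    exact (U k).2
  induction k with
  | zero => exact (eq_univ_of_forall fun _ _ h => absurd h (Nat.not_lt_zero _)).symm
  | succ k ih =>
    ext z
    simp only [Nat.forall_lt_succ_right]
    exact and_congr_left fun _ => Set.ext_iff.1 ih z

variable [TopologicalSpace X] [T2Space X] [FirstCountableTopology X]

theorem iInter_closure_image_subset_image_pi (hf : Continuous f) (n : ℕ → ℕ) :
    ⋂ k, closure (f '' {z | ∀ i < k, z i ≤ n i}) ⊆ f '' univ.pi fun i => Iic (n i) := by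
  intro y hy
  obtain ⟨V, hV⟩ := (𝓝 y).exists_antitone_basis
  have exists_near (k : ℕ) : ∃ z : ℕ → ℕ, (∀ i < k, z i ≤ n i) ∧ f z ∈ V k := by
    obtain ⟨-, hzV, z, hz, rfl⟩ := mem_closure_iff_nhds.1 (mem_iInter.1 hy k) (V k) (hV.mem k)
    exact ⟨z, hz, hzV⟩
  choose z hz hzV using exists_near
  have hfz : Tendsto (fun k => f (z k)) atTop (𝓝 y) := hV.tendsto hzV
  have hcompact : IsCompact (univ.pi fun i => Iic (n i)) :=
    isCompact_univ_pi fun i => (finite_Iic (n i)).isCompact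
  obtain ⟨w, hw, φ, hφ, hlim⟩ := hcompact.tendsto_subseq (x := fun k i => min (z k i) (n i))
    fun k i _ => mem_Iic.2 (min_le_right _ _)
  have hzlim : Tendsto (z ∘ φ) atTop (𝓝 w) := by
    rw [tendsto_pi_nhds] at hlim ⊢
    intro i
    refine (hlim i).congr' ?_
    filter_upwards [eventually_gt_atTop i] with k hk
    exact min_eq_left (hz (φ k) i (hk.trans_le (hφ.id_le k)))
  exact ⟨w, hw, tendsto_nhds_unique ((hf.tendsto w).comp hzlim) (hfz.comp hφ.tendsto_atTop)⟩

variable [MeasurableSpace X] [OpensMeasurableSpace X]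

theorem exists_isCompact_subset_range_le_measure (μ : Measure X) [IsFiniteMeasure μ]
    (hf : Continuous f) (hc : c < μ (range f)) :
    ∃ K ⊆ range f, IsCompact K ∧ c ≤ μ K := by
  obtain ⟨n, hn⟩ := exists_forall_lt_measure_image_bounded μ hc
  have hanti : Antitone fun k => closure (f '' {z | ∀ i < k, z i ≤ n i}) := fun _ _ h =>
    closure_mono (image_mono fun _ hz i hi => hz i (hi.trans_le h))
  refine ⟨f '' univ.pi fun i => Iic (n i), image_subset_range _ _,
    (isCompact_univ_pi fun i => (finite_Iic (n i)).isCompact).image hf, ?_⟩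
  calc c ≤ ⨅ k, μ (closure (f '' {z | ∀ i < k, z i ≤ n i})) :=
        le_iInf fun k => (hn k).le.trans (measure_mono subset_closure)
    _ = μ (⋂ k, closure (f '' {z | ∀ i < k, z i ≤ n i})) :=
        (hanti.measure_iInter (fun _ => isClosed_closure.measurableSet.nullMeasurableSet)
          ⟨0, measure_ne_top _ _⟩).symm
    _ ≤ μ (f '' univ.pi fun i => Iic (n i)) :=
        measure_mono (iInter_closure_image_subset_image_pi hf n)

theorem nullMeasurableSet_of_analyticSet (μ : Measure X) [SFinite μ] {s : Set X}
    (hs : AnalyticSet s) : NullMeasurableSet s μ := by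
  suffices hfin : ∀ ν : Measure X, IsFiniteMeasure ν → NullMeasurableSet s ν from
    (hfin μ.toFinite inferInstance).mono_ac (absolutelyContinuous_toFinite μ)
  intro ν _
  rw [AnalyticSet] at hs
  obtain rfl | ⟨f, hf, rfl⟩ := hs
  · exact .empty
  obtain hnull | hpos := eq_or_ne (ν (range f)) 0
  · exact .of_null hnull
  obtain ⟨u, -, hu, hlim⟩ := exists_seq_strictMono_tendsto' (pos_iff_ne_zero.2 hpos)
  choose K hKs hKc hKm using fun k => exists_isCompact_subset_range_le_measure ν hf (hu k).2
  have hmeas : NullMeasurableSet (⋃ k, K k) ν :=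
    (MeasurableSet.iUnion fun k => (hKc k).measurableSet).nullMeasurableSet
  exact hmeas.congr <| ae_eq_of_subset_of_measure_ge (iUnion_subset hKs)
    (le_of_tendsto' hlim fun k => (hKm k).trans (measure_mono (subset_iUnion K k))) hmeas
    (measure_ne_top _ _)

end AnalyticSets

theorem nullMeasurableSet_image {Z X : Type*} [MeasurableSpace Z] [StandardBorelSpace Z]
    [MeasurableSpace X] [StandardBorelSpace X] (μ : Measure X) [SFinite μ] {π : Z → X}
    (hπ : Measurable π) {s : Set Z} (hs : MeasurableSet s) : NullMeasurableSet (π '' s) μ :=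
  let := upgradeStandardBorel X
  nullMeasurableSet_of_analyticSet μ (hs.analyticSet_image hπ)

section CountableToOne

variable {Z X : Type*} {π : Z → X} {F V : Set Z}

/-- The points of `X` over which `F` has exactly one point. -/
def singletonFibers (π : Z → X) (F : Set Z) : Set X := {x | ∃! z, z ∈ F ∧ π z = x}

theorem injOn_inter_preimage_singletonFibers (π : Z → X) (F : Set Z) :
    InjOn π (F ∩ π ⁻¹' singletonFibers π F) := by
  rintro a ⟨haF, ha⟩ b ⟨hbF, -⟩ hab
  exact ExistsUnique.unique ha ⟨haF, rfl⟩ ⟨hbF, hab.symm⟩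

theorem singletonFibers_eq_sdiff_of_isTopologicalBasis [TopologicalSpace Z] [T2Space Z]
    {b : Set (Set Z)} (hb : TopologicalSpace.IsTopologicalBasis b) (π : Z → X) (F : Set Z) :
    singletonFibers π F =
      π '' F \ ⋃ u ∈ b, ⋃ v ∈ {v ∈ b | Disjoint u v}, π '' (F ∩ u) ∩ π '' (F ∩ v) := by
  ext x
  simp only [mem_sdiff, mem_iUnion, not_exists]
  constructor
  · rintro ⟨z, ⟨hzF, rfl⟩, hz⟩
    refine ⟨⟨z, hzF, rfl⟩, ?_⟩
    rintro u - v ⟨-, huv⟩ ⟨⟨p, ⟨hpF, hpu⟩, hp⟩, ⟨q, ⟨hqF, hqv⟩, hq⟩⟩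
    obtain rfl : p = q := (hz p ⟨hpF, hp⟩).trans (hz q ⟨hqF, hq⟩).symm
    exact disjoint_left.1 huv hpu hqv
  · rintro ⟨⟨z, hzF, rfl⟩, h⟩
    refine ⟨z, ⟨hzF, rfl⟩, ?_⟩
    rintro w ⟨hwF, hw⟩
    by_contra hne
    obtain ⟨U, V, hU, hV, hwU, hzV, hUV⟩ := t2_separation hne
    obtain ⟨u, hu, hwu, huU⟩ := hb.exists_subset_of_mem_open hwU hU
    obtain ⟨v, hv, hzv, hvV⟩ := hb.exists_subset_of_mem_open hzV hV
    exact h u hu v ⟨hv, hUV.mono huU hvV⟩ ⟨⟨w, ⟨hwF, hwu⟩, hw⟩, ⟨z, ⟨hzF, hzv⟩, rfl⟩⟩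

theorem nullMeasurableSet_singletonFibers [MeasurableSpace Z] [StandardBorelSpace Z]
    [MeasurableSpace X] [StandardBorelSpace X] (μ : Measure X) [SFinite μ] (hπ : Measurable π)
    (hF : MeasurableSet F) : NullMeasurableSet (singletonFibers π F) μ := by
  let := upgradeStandardBorel Z
  obtain ⟨b, hbc, -, hb⟩ := TopologicalSpace.exists_countable_basis Z
  have himage : ∀ u ∈ b, NullMeasurableSet (π '' (F ∩ u)) μ := fun u hu =>
    nullMeasurableSet_image μ hπ (hF.inter (hb.isOpen hu).measurableSet)
  rw [singletonFibers_eq_sdiff_of_isTopologicalBasis hb]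
  exact (nullMeasurableSet_image μ hπ hF).diff <| .biUnion hbc fun u hu =>
    .biUnion (hbc.mono (sep_subset _ _)) fun v hv => (himage u hu).inter (himage v hv.1)

theorem exists_isOpen_singleton_of_countable {Y : Type*} [TopologicalSpace Y] [BaireSpace Y]
    [T1Space Y] [Countable Y] [Nonempty Y] : ∃ y : Y, IsOpen {y} := by
  obtain ⟨y, hy⟩ := nonempty_interior_of_iUnion_of_closed
    (fun y : Y => isClosed_singleton (x := y)) (iUnion_of_singleton Y)
  exact ⟨y, interior_eq_iff_isOpen.1 (hy.subset_singleton_iff.1 interior_subset)⟩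

variable [MeasurableSpace Z]

/-- `s` is covered by countably many measurable partial sections of `π`. These sets form a
`σ`-ideal. -/
def IsCountablySectioned (π : Z → X) (s : Set Z) : Prop :=
  ∃ 𝒢 : Set (Set Z), 𝒢.Countable ∧ (∀ G ∈ 𝒢, MeasurableSet G ∧ InjOn π G) ∧ s ⊆ ⋃₀ 𝒢

theorem IsCountablySectioned.iUnion {ι : Type*} [Countable ι] {s : ι → Set Z}
    (hs : ∀ i, IsCountablySectioned π (s i)) : IsCountablySectioned π (⋃ i, s i) := by
  choose 𝒢 hcount hsec hcov using hs
  refine ⟨⋃ i, 𝒢 i, countable_iUnion hcount, fun G hG => ?_, ?_⟩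
  · obtain ⟨i, hi⟩ := mem_iUnion.1 hG
    exact hsec i G hi
  · rw [sUnion_iUnion]
    exact iUnion_mono hcov

theorem IsCountablySectioned.union_of_injOn {s G : Set Z} (hs : IsCountablySectioned π s)
    (hG : MeasurableSet G) (hinj : InjOn π G) : IsCountablySectioned π (s ∪ G) := by
  obtain ⟨𝒢, hcount, hsec, hcov⟩ := hs
  refine ⟨insert G 𝒢, hcount.insert G, forall_mem_insert.2 ⟨⟨hG, hinj⟩, hsec⟩, ?_⟩
  rw [sUnion_insert, union_comm]
  exact union_subset_union_right G hcov

/-- The sets that can remain after removing countably many measurable partial sections of `π`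
while keeping all fibres closed. A smallest one, up to null sets, plays the part of the perfect
kernel in the Cantor–Bendixson theorem. -/
structure IsSectionRemainder [TopologicalSpace Z] (π : Z → X) (F : Set Z) : Prop where
  measurableSet : MeasurableSet F
  isClosed_inter_fiber : ∀ x, IsClosed (F ∩ π ⁻¹' {x})
  isCountablySectioned_compl : IsCountablySectioned π Fᶜ

namespace IsSectionRemainder

variable [TopologicalSpace Z]

protected theorem univ (hclosed : ∀ x, IsClosed (π ⁻¹' {x})) : IsSectionRemainder π univ where
  measurableSet := .univ
  isClosed_inter_fiber x := by simpa using hclosed x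
  isCountablySectioned_compl := ⟨∅, countable_empty, by simp, by simp⟩

theorem iInter {ι : Type*} [Countable ι] [Nonempty ι] {F : ι → Set Z}
    (hF : ∀ i, IsSectionRemainder π (F i)) : IsSectionRemainder π (⋂ i, F i) where
  measurableSet := .iInter fun i => (hF i).measurableSet
  isClosed_inter_fiber x := by
    rw [iInter_inter]
    exact isClosed_iInter fun i => (hF i).isClosed_inter_fiber x
  isCountablySectioned_compl := by
    rw [compl_iInter]
    exact .iUnion fun i => (hF i).isCountablySectioned_compl

theorem sdiff [OpensMeasurableSpace Z] [MeasurableSpace X] (hF : IsSectionRemainder π F)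
    (hπ : Measurable π) (hV : IsOpen V) {U : Set X} (hU : MeasurableSet U)
    (hUs : U ⊆ singletonFibers π (F ∩ V)) : IsSectionRemainder π (F \ (V ∩ π ⁻¹' U)) where
  measurableSet := hF.measurableSet.diff (hV.measurableSet.inter (hπ hU))
  isClosed_inter_fiber x := by
    by_cases hx : x ∈ U
    · have heq : (F \ (V ∩ π ⁻¹' U)) ∩ π ⁻¹' {x} = (F ∩ π ⁻¹' {x}) \ V := by
        ext z
        simp only [mem_inter_iff, mem_sdiff, mem_preimage, mem_singleton_iff]
        grind
      rw [heq]
      exact (hF.isClosed_inter_fiber x).sdiff hV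
    · have heq : (F \ (V ∩ π ⁻¹' U)) ∩ π ⁻¹' {x} = F ∩ π ⁻¹' {x} := by
        ext z
        simp only [mem_inter_iff, mem_sdiff, mem_preimage, mem_singleton_iff]
        grind
      rw [heq]
      exact hF.isClosed_inter_fiber x
  isCountablySectioned_compl := by
    have heq : (F \ (V ∩ π ⁻¹' U))ᶜ = Fᶜ ∪ F ∩ (V ∩ π ⁻¹' U) := by
      ext z
      simp only [mem_compl_iff, mem_sdiff, mem_union, mem_inter_iff]
      tauto
    rw [heq]
    refine hF.isCountablySectioned_compl.union_of_injOn
      (hF.measurableSet.inter (hV.measurableSet.inter (hπ hU)))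
      ((injOn_inter_preimage_singletonFibers π (F ∩ V)).mono ?_)
    rw [← inter_assoc]
    exact inter_subset_inter_right _ (preimage_mono hUs)

theorem exists_minimal [MeasurableSpace X] (hclosed : ∀ x, IsClosed (π ⁻¹' {x}))
    (μ : Measure X) {b : Set (Set Z)} (hb : b.Countable) :
    ∃ F, IsSectionRemainder π F ∧ ∀ u ∈ b, ∀ F', IsSectionRemainder π F' →
      μ (π '' (F ∩ u)) ≤ μ (π '' (F' ∩ u)) := by
  obtain rfl | hne := b.eq_empty_or_nonempty
  · exact ⟨_, .univ hclosed, by simp⟩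
  obtain ⟨u, rfl⟩ := hb.exists_eq_range hne
  have exists_minimizing (i : ℕ) : ∃ F : ℕ → Set Z, (∀ n, IsSectionRemainder π (F n)) ∧
      ∀ F', IsSectionRemainder π F' → μ (π '' ((⋂ n, F n) ∩ u i)) ≤ μ (π '' (F' ∩ u i)) := by
    obtain ⟨s, -, hs, hmem⟩ := exists_seq_tendsto_sInf
      (S := (fun F => μ (π '' (F ∩ u i))) '' {F | IsSectionRemainder π F})
      ⟨_, _, .univ hclosed, rfl⟩ (OrderBot.bddBelow _)
    choose F hF hFs using hmem
    refine ⟨F, hF, fun F' hF' => (ge_of_tendsto' hs fun n => ?_).trans (sInf_le ⟨F', hF', rfl⟩)⟩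
    rw [← hFs n]
    exact measure_mono (image_mono (inter_subset_inter_left _ (iInter_subset _ _)))
  choose F hF hmin using exists_minimizing
  refine ⟨⋂ i, ⋂ n, F i n, .iInter fun i => .iInter (hF i), forall_mem_range.2 fun i F' hF' => ?_⟩
  exact (measure_mono (image_mono (inter_subset_inter_left _ (iInter_subset _ i)))).trans
    (hmin i F' hF')

theorem measure_singletonFibers_eq_zero [PolishSpace Z] [BorelSpace Z] [MeasurableSpace X]
    [StandardBorelSpace X] (hF : IsSectionRemainder π F) {μ : Measure X} [IsFiniteMeasure μ]
    (hπ : Measurable π) (hV : IsOpen V)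
    (hmin : ∀ F', IsSectionRemainder π F' → μ (π '' (F ∩ V)) ≤ μ (π '' (F' ∩ V))) :
    μ (singletonFibers π (F ∩ V)) = 0 := by
  obtain ⟨U, hUs, hU, hUae⟩ := (nullMeasurableSet_singletonFibers μ hπ
    (hF.measurableSet.inter hV.measurableSet)).exists_measurable_subset_ae_eq
  rw [← measure_congr hUae]
  have hF' := hF.sdiff hπ hV hU hUs
  have hae : (π '' ((F \ (V ∩ π ⁻¹' U)) ∩ V) : Set X) =ᵐ[μ] π '' (F ∩ V) :=
    ae_eq_of_subset_of_measure_ge (image_mono (inter_subset_inter_left _ sdiff_subset))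
      (hmin _ hF') (nullMeasurableSet_image μ hπ (hF'.measurableSet.inter hV.measurableSet))
      (measure_ne_top _ _)
  refine measure_mono_null (fun x hx => ?_) (ae_le_set.1 hae.symm.le)
  obtain ⟨z, ⟨hz, rfl⟩, -⟩ := hUs hx
  refine ⟨⟨z, hz, rfl⟩, ?_⟩
  rintro ⟨w, ⟨hwF', hwV⟩, hw⟩
  exact hwF'.2 ⟨hwV, by rwa [mem_preimage, hw]⟩

end IsSectionRemainder

theorem exists_isCountablySectioned_of_isClosed_fiber [TopologicalSpace Z] [PolishSpace Z]
    [BorelSpace Z] [MeasurableSpace X] [StandardBorelSpace X] (μ : Measure X) [IsFiniteMeasure μ]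
    (hπ : Measurable π) (hclosed : ∀ x, IsClosed (π ⁻¹' {x}))
    (hcount : ∀ x, (π ⁻¹' {x}).Countable) :
    ∃ s, IsCountablySectioned π s ∧ μ (π '' sᶜ) = 0 := by
  obtain ⟨b, hbc, -, hb⟩ := TopologicalSpace.exists_countable_basis Z
  obtain ⟨F, hF, hmin⟩ := IsSectionRemainder.exists_minimal hclosed μ hbc
  refine ⟨Fᶜ, hF.isCountablySectioned_compl, measure_mono_null ?_ <|
    (measure_biUnion_null_iff hbc).2 fun u hu =>
      hF.measure_singletonFibers_eq_zero hπ (hb.isOpen hu) (hmin u hu)⟩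
  rw [compl_compl]
  rintro _ ⟨z, hz, rfl⟩
  -- Every fibre of `F` is countable and closed, so by the Baire category theorem it has an
  -- isolated point.
  let C := F ∩ π ⁻¹' {π z}
  have : Countable C := ((hcount (π z)).mono inter_subset_right).to_subtype
  have : Nonempty C := ⟨z, hz, rfl⟩
  have : PolishSpace C := (hF.isClosed_inter_fiber (π z)).polishSpace
  obtain ⟨w, hw⟩ := exists_isOpen_singleton_of_countable (Y := C)
  obtain ⟨W, hW, hWw⟩ := isOpen_induced_iff.1 hw
  have hwW : w.1 ∈ W := by
    rw [← mem_preimage (f := Subtype.val), hWw]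
    rfl
  obtain ⟨u, hu, hwu, huW⟩ := hb.exists_subset_of_mem_open hwW hW
  refine mem_biUnion hu ⟨w, ⟨⟨w.2.1, hwu⟩, w.2.2⟩, ?_⟩
  rintro p ⟨⟨hpF, hpu⟩, hp⟩
  have hpw : (⟨p, hpF, hp⟩ : C) ∈ ({w} : Set C) := by
    rw [← hWw]
    exact huW hpu
  exact congrArg Subtype.val hpw

/-- The **Lusin–Novikov theorem**, up to null sets. -/
theorem exists_countable_injOn_cover [StandardBorelSpace Z] [MeasurableSpace X]
    [StandardBorelSpace X] (μ : Measure X) [SFinite μ] (hπ : Measurable π)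
    (hcount : ∀ x, (π ⁻¹' {x}).Countable) :
    ∃ G : ℕ → Set Z, (∀ n, MeasurableSet (G n)) ∧ (∀ n, InjOn π (G n)) ∧
      μ (π '' (⋃ n, G n)ᶜ) = 0 := by
  let := upgradeStandardBorel X
  obtain ⟨t, hbt, hpt⟩ := StandardBorelSpace.polish (α := Z)
  obtain ⟨t', hle, hcont, hpt'⟩ := hπ.exists_continuous
  have : @BorelSpace Z t' _ :=
    @BorelSpace.mk _ t' _ (hbt.measurable_eq.trans (borel_eq_borel_of_le hpt' hpt hle).symm)
  obtain ⟨s, ⟨𝒢, h𝒢, hsec, hcov⟩, hs⟩ :=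
    @exists_isCountablySectioned_of_isClosed_fiber Z X π _ t' hpt' _ _ _ μ.toFinite _ hπ
      (fun x => isClosed_singleton.preimage hcont) hcount
  obtain ⟨G, hG⟩ := (h𝒢.insert ∅).exists_eq_range (insert_nonempty _ _)
  have hmem (n : ℕ) : MeasurableSet (G n) ∧ InjOn π (G n) := by
    obtain hn | hn : G n ∈ insert ∅ 𝒢 := hG ▸ mem_range_self n
    · exact hn ▸ ⟨.empty, injOn_empty _⟩
    · exact hsec _ hn
  refine ⟨G, fun n => (hmem n).1, fun n => (hmem n).2,
    absolutelyContinuous_toFinite μ (measure_mono_null (image_mono (compl_subset_compl.2 ?_)) hs)⟩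
  rwa [← sUnion_range, ← hG, sUnion_insert, empty_union]

end CountableToOne

section FiberCounting

variable {Y X : Type*} [MeasurableSpace Y] [MeasurableSpace X] {π : Y → X} {Γ W : Set Y}
  {ν : Measure X} {P : ℕ → Set Y}

/-- The measure on `Γ` obtained by integrating the counting measures of the fibres of `π`. For
the two projections of `graph R` these are `leftMeasure R ν` and `rightMeasure R ν`. -/
noncomputable def fiberCounting (π : Y → X) (Γ : Set Y) (ν : Measure X) : Measure Y :=
  ν.bind fun x => Measure.count.restrict {p | p ∈ Γ ∧ π p = x}

/-- A countable measurable partition of `Γ`, up to a set with null image under `π`, into sets on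
which `π` is injective. -/
structure IsSectionPartition (π : Y → X) (Γ : Set Y) (ν : Measure X) (P : ℕ → Set Y) : Prop where
  measurableSet : ∀ k, MeasurableSet (P k)
  subset : ∀ k, P k ⊆ Γ
  disjoint : Pairwise (Function.onFun Disjoint P)
  injOn : ∀ k, InjOn π (P k)
  null : ν (π '' (Γ \ ⋃ k, P k)) = 0

namespace IsSectionPartition

theorem count_restrict_apply [MeasurableSingletonClass Y] (h : IsSectionPartition π Γ ν P)
    (hW : MeasurableSet W) (k : ℕ) (x : X) :
    Measure.count.restrict (P k ∩ π ⁻¹' {x}) W = (π '' (W ∩ P k)).indicator 1 x := by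
  rw [Measure.restrict_apply hW]
  by_cases hx : x ∈ π '' (W ∩ P k)
  · rw [indicator_of_mem hx]
    obtain ⟨z, ⟨hzW, hzP⟩, rfl⟩ := hx
    have hsingleton : W ∩ (P k ∩ π ⁻¹' {π z}) = {z} :=
      Subset.antisymm (fun w hw => h.injOn k hw.2.1 hzP hw.2.2)
        (singleton_subset_iff.2 ⟨hzW, hzP, rfl⟩)
    rw [hsingleton, Measure.count_singleton, Pi.one_apply]
  · have hempty : W ∩ (P k ∩ π ⁻¹' {x}) = ∅ :=
      eq_empty_of_forall_notMem fun w hw => hx ⟨w, ⟨hw.1, hw.2.1⟩, hw.2.2⟩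
    rw [hempty, measure_empty, indicator_of_notMem hx]

theorem ae_eq_sum [MeasurableSingletonClass X] (h : IsSectionPartition π Γ ν P)
    (hπ : Measurable π) :
    (fun x => Measure.count.restrict {p | p ∈ Γ ∧ π p = x}) =ᵐ[ν]
      fun x => Measure.sum fun k => Measure.count.restrict (P k ∩ π ⁻¹' {x}) := by
  filter_upwards [measure_eq_zero_iff_ae_notMem.1 h.null] with x hx
  have hfiber : {p | p ∈ Γ ∧ π p = x} = ⋃ k, P k ∩ π ⁻¹' {x} := by
    rw [← iUnion_inter]
    ext p
    constructor
    · rintro ⟨hp, rfl⟩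
      exact ⟨by_contra fun hpP => hx ⟨p, ⟨hp, hpP⟩, rfl⟩, rfl⟩
    · rintro ⟨hp, hpx⟩
      exact ⟨iUnion_subset h.subset hp, hpx⟩
  rw [hfiber]
  exact Measure.restrict_iUnion
    (fun i j hij => (h.disjoint hij).mono inter_subset_left inter_subset_left)
    fun k => (h.measurableSet k).inter (hπ (measurableSet_singleton x))

theorem measure_image_eq_measure_iUnion_image (h : IsSectionPartition π Γ ν P) (hWΓ : W ⊆ Γ) :
    ν (π '' W) = ν (⋃ k, π '' (W ∩ P k)) := by
  refine le_antisymm ?_ (measure_mono (iUnion_subset fun k => image_mono inter_subset_left))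
  have hsub : π '' W ⊆ (⋃ k, π '' (W ∩ P k)) ∪ π '' (Γ \ ⋃ k, P k) := by
    rw [← image_iUnion, ← inter_iUnion, ← image_union]
    exact image_mono fun z hz => (em (z ∈ ⋃ k, P k)).imp (And.intro hz) (And.intro (hWΓ hz))
  calc ν (π '' W) ≤ ν (⋃ k, π '' (W ∩ P k)) + ν (π '' (Γ \ ⋃ k, P k)) :=
        (measure_mono hsub).trans (measure_union_le _ _)
    _ = ν (⋃ k, π '' (W ∩ P k)) := by rw [h.null, add_zero]

variable [StandardBorelSpace Y] [StandardBorelSpace X]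

theorem measurableSet_image (h : IsSectionPartition π Γ ν P) (hπ : Measurable π)
    (hW : MeasurableSet W) (k : ℕ) : MeasurableSet (π '' (W ∩ P k)) :=
  (hW.inter (h.measurableSet k)).image_of_measurable_injOn hπ
    ((h.injOn k).mono inter_subset_right)

theorem measurable_sum (h : IsSectionPartition π Γ ν P) (hπ : Measurable π) :
    Measurable fun x => Measure.sum fun k => Measure.count.restrict (P k ∩ π ⁻¹' {x}) := by
  refine Measure.measurable_of_measurable_coe _ fun W hW => ?_
  simp only [Measure.sum_apply _ hW, h.count_restrict_apply hW]
  exact Measurable.tsum fun k => measurable_one.indicator (h.measurableSet_image hπ hW k)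

theorem fiberCounting_apply (h : IsSectionPartition π Γ ν P) (hπ : Measurable π)
    (hW : MeasurableSet W) : fiberCounting π Γ ν W = ∑' k, ν (π '' (W ∩ P k)) := by
  rw [fiberCounting, Measure.bind_congr_right (h.ae_eq_sum hπ),
    Measure.bind_apply hW (h.measurable_sum hπ).aemeasurable]
  simp only [Measure.sum_apply _ hW, h.count_restrict_apply hW]
  rw [lintegral_tsum fun k =>
    (measurable_one.indicator (h.measurableSet_image hπ hW k)).aemeasurable]
  exact tsum_congr fun k => lintegral_indicator_one (h.measurableSet_image hπ hW k)

theorem fiberCounting_apply_of_injOn (h : IsSectionPartition π Γ ν P) (hπ : Measurable π)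
    (hW : MeasurableSet W) (hWΓ : W ⊆ Γ) (hinj : InjOn π W) :
    fiberCounting π Γ ν W = ν (π '' W) := by
  rw [h.fiberCounting_apply hπ hW, h.measure_image_eq_measure_iUnion_image hWΓ,
    measure_iUnion _ (h.measurableSet_image hπ hW)]
  exact fun i j hij => ((h.disjoint hij).mono inter_subset_right inter_subset_right).image hinj
    inter_subset_left inter_subset_left

theorem fiberCounting_eq_zero_iff (h : IsSectionPartition π Γ ν P) (hπ : Measurable π)
    (hW : MeasurableSet W) (hWΓ : W ⊆ Γ) : fiberCounting π Γ ν W = 0 ↔ ν (π '' W) = 0 := by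
  rw [h.fiberCounting_apply hπ hW, h.measure_image_eq_measure_iUnion_image hWΓ,
    ENNReal.tsum_eq_zero, measure_iUnion_null_iff]

theorem fiberCounting_compl (h : IsSectionPartition π Γ ν P) (hπ : Measurable π) :
    fiberCounting π Γ ν (⋃ k, P k)ᶜ = 0 := by
  rw [h.fiberCounting_apply hπ (MeasurableSet.iUnion h.measurableSet).compl]
  have hempty (k : ℕ) : (⋃ k, P k)ᶜ ∩ P k = ∅ :=
    (disjoint_compl_left.mono_right (subset_iUnion P k)).inter_eq
  simp only [hempty, image_empty, measure_empty, tsum_zero]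

theorem sigmaFinite_fiberCounting [SigmaFinite ν] (h : IsSectionPartition π Γ ν P)
    (hπ : Measurable π) : SigmaFinite (fiberCounting π Γ ν) := by
  refine Measure.sigmaFinite_of_countable (S := insert (⋃ k, P k)ᶜ
    (range fun i : ℕ × ℕ => P i.1 ∩ π ⁻¹' spanningSets ν i.2))
    ((countable_range _).insert _) (forall_mem_insert.2 ⟨?_, forall_mem_range.2 fun i => ?_⟩) ?_
  · rw [h.fiberCounting_compl hπ]
    exact ENNReal.zero_lt_top
  · rw [h.fiberCounting_apply_of_injOn hπ
      ((h.measurableSet i.1).inter (hπ (measurableSet_spanningSets ν i.2)))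
      (inter_subset_left.trans (h.subset i.1)) ((h.injOn i.1).mono inter_subset_left)]
    refine (measure_mono ?_).trans_lt (measure_spanningSets_lt_top ν i.2)
    exact (image_mono inter_subset_right).trans (image_preimage_subset _ _)
  · rw [sUnion_insert, sUnion_range, iUnion_prod', ← compl_subset_iff_union, compl_compl]
    simp only [← inter_iUnion, ← preimage_iUnion, iUnion_spanningSets, preimage_univ, inter_univ]
    exact Subset.rfl

end IsSectionPartition

end FiberCounting

section Relations

variable {α β ι : Type*}

theorem image_fst_eq_dom (W : SetRel α β) : Prod.fst '' W = W.dom := by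
  ext x
  simp only [Set.mem_image, SetRel.mem_dom, Prod.exists, exists_and_right, exists_eq_right]

theorem image_snd_eq_cod (W : SetRel α β) : Prod.snd '' W = W.cod := by
  ext y
  simp only [Set.mem_image, SetRel.mem_cod, Prod.exists, exists_eq_right]

theorem dom_union (V W : SetRel α β) : SetRel.dom (V ∪ W) = V.dom ∪ W.dom := by
  simp only [← image_fst_eq_dom, image_union]

theorem cod_union (V W : SetRel α β) : SetRel.cod (V ∪ W) = V.cod ∪ W.cod := by
  simp only [← image_snd_eq_cod, image_union]

theorem dom_iUnion (W : ι → SetRel α β) : SetRel.dom (⋃ i, W i) = ⋃ i, (W i).dom := by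
  simp only [← image_fst_eq_dom, image_iUnion]

theorem cod_iUnion (W : ι → SetRel α β) : SetRel.cod (⋃ i, W i) = ⋃ i, (W i).cod := by
  simp only [← image_snd_eq_cod, image_iUnion]

theorem inv_iUnion (W : ι → SetRel α β) : SetRel.inv (⋃ i, W i) = ⋃ i, (W i).inv :=
  preimage_iUnion

theorem injOn_snd_iff_injOn_fst_inv {W : SetRel α β} :
    InjOn Prod.snd W ↔ InjOn Prod.fst W.inv :=
  ⟨fun h _ hp _ hq e => Prod.swap_injective (h hp hq e),
    fun h _ hp _ hq e => Prod.swap_injective (h hp hq e)⟩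

theorem inv_subset_graph {R : Setoid α} {V : SetRel α α} (hV : V ⊆ graph R) : V.inv ⊆ graph R :=
  fun _ hp => R.symm (hV hp)

end Relations

variable {X ι : Type*} [MeasurableSpace X] {R : Setoid X} {μ ν : Measure X}
  {P Q V W : SetRel X X}

/-- Measurable subsets of `R` that are graphs of injective partial maps. -/
structure IsBisection (R : Setoid X) (W : SetRel X X) : Prop where
  measurableSet : MeasurableSet W
  subset_graph : W ⊆ graph R
  injOn_fst : InjOn Prod.fst W
  injOn_snd : InjOn Prod.snd W

section Bisections

theorem IsNonsingular.measure_cod_eq_zero (hR : IsNonsingular R μ) (hV : V ⊆ graph R)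
    (h : μ V.dom = 0) : μ V.cod = 0 := by
  refine measure_mono_null ?_ (hR.saturation_null _ h)
  rintro y ⟨x, hxy⟩
  exact ⟨x, ⟨y, hxy⟩, hV hxy⟩

theorem IsNonsingular.measure_dom_eq_zero_iff (hR : IsNonsingular R μ) (hV : V ⊆ graph R) :
    μ V.dom = 0 ↔ μ V.cod = 0 :=
  ⟨hR.measure_cod_eq_zero hV, hR.measure_cod_eq_zero (inv_subset_graph hV)⟩

namespace IsBisection

theorem mono (hW : IsBisection R W) (hV : MeasurableSet V) (hVW : V ⊆ W) : IsBisection R V :=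
  ⟨hV, hVW.trans hW.subset_graph, hW.injOn_fst.mono hVW, hW.injOn_snd.mono hVW⟩

theorem inv (hW : IsBisection R W) : IsBisection R W.inv where
  measurableSet := measurable_swap hW.measurableSet
  subset_graph := inv_subset_graph hW.subset_graph
  injOn_fst := injOn_snd_iff_injOn_fst_inv.1 hW.injOn_snd
  injOn_snd := injOn_snd_iff_injOn_fst_inv.2 hW.injOn_fst

theorem rel (hW : IsBisection R W) {x y : X} (h : (x, y) ∈ W) : R x y :=
  hW.subset_graph h

theorem cod_unique (hW : IsBisection R W) {x y y' : X} (h : (x, y) ∈ W) (h' : (x, y') ∈ W) :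
    y = y' :=
  congrArg Prod.snd (hW.injOn_fst h h' rfl)

theorem dom_unique (hW : IsBisection R W) {x x' y : X} (h : (x, y) ∈ W) (h' : (x', y) ∈ W) :
    x = x' :=
  hW.inv.cod_unique h h'

theorem injOn_fst_iUnion {W : ι → SetRel X X} (hW : ∀ i, IsBisection R (W i))
    (hdom : Pairwise (Function.onFun Disjoint fun i => (W i).dom)) :
    InjOn Prod.fst (⋃ i, W i) := by
  rintro ⟨x, y⟩ hp ⟨_, y'⟩ hq (rfl : x = _)
  obtain ⟨i, hi⟩ := mem_iUnion.1 hp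
  obtain ⟨j, hj⟩ := mem_iUnion.1 hq
  obtain rfl : i = j := hdom.eq (not_disjoint_iff.2 ⟨x, ⟨y, hi⟩, ⟨y', hj⟩⟩)
  exact (hW i).injOn_fst hi hj rfl

theorem iUnion [Countable ι] {W : ι → SetRel X X} (hW : ∀ i, IsBisection R (W i))
    (hdom : Pairwise (Function.onFun Disjoint fun i => (W i).dom))
    (hcod : Pairwise (Function.onFun Disjoint fun i => (W i).cod)) :
    IsBisection R (⋃ i, W i) where
  measurableSet := MeasurableSet.iUnion fun i => (hW i).measurableSet
  subset_graph := iUnion_subset fun i => (hW i).subset_graph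
  injOn_fst := injOn_fst_iUnion hW hdom
  injOn_snd := by
    rw [injOn_snd_iff_injOn_fst_inv, inv_iUnion]
    exact injOn_fst_iUnion (fun i => (hW i).inv) hcod

theorem union (hV : IsBisection R V) (hW : IsBisection R W) (hdom : Disjoint V.dom W.dom)
    (hcod : Disjoint V.cod W.cod) : IsBisection R (V ∪ W) := by
  rw [union_eq_iUnion]
  refine iUnion (Bool.forall_bool.2 ⟨hW, hV⟩) ?_ ?_
  · simpa only [Bool.apply_cond SetRel.dom] using pairwise_disjoint_on_bool.2 hdom
  · simpa only [Bool.apply_cond SetRel.cod] using pairwise_disjoint_on_bool.2 hcod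

theorem dom_sdiff (hW : IsBisection R W) (hVW : V ⊆ W) :
    SetRel.dom (W \ V) = W.dom \ V.dom := by
  refine Subset.antisymm ?_ ?_
  · rintro x ⟨y, hxy, hxyV⟩
    refine ⟨⟨y, hxy⟩, fun ⟨z, hxz⟩ => hxyV ?_⟩
    rwa [hW.cod_unique hxy (hVW hxz)]
  · rintro x ⟨⟨y, hxy⟩, hx⟩
    exact ⟨y, hxy, fun h => hx ⟨y, h⟩⟩

theorem cod_sdiff (hW : IsBisection R W) (hVW : V ⊆ W) :
    SetRel.cod (W \ V) = W.cod \ V.cod :=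
  hW.inv.dom_sdiff (SetRel.inv_mono hVW)

variable [StandardBorelSpace X]

theorem measurableSet_dom (hW : IsBisection R W) : MeasurableSet W.dom := by
  rw [← image_fst_eq_dom]
  exact hW.measurableSet.image_of_measurable_injOn measurable_fst hW.injOn_fst

theorem measurableSet_cod (hW : IsBisection R W) : MeasurableSet W.cod :=
  hW.inv.measurableSet_dom

open scoped SetRel in
theorem measurableSet_comp (hP : IsBisection R P) (hQ : IsBisection R Q) :
    MeasurableSet (P ○ Q) := by
  have hmeas : MeasurableSet (P ×ˢ Q ∩ {q : (X × X) × (X × X) | q.1.2 = q.2.1}) :=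
    (hP.measurableSet.prod hQ.measurableSet).inter
      (measurableSet_eq_fun (by fun_prop) (by fun_prop))
  have hcomp : P ○ Q = (fun q : (X × X) × (X × X) => (q.1.1, q.2.2)) ''
      (P ×ˢ Q ∩ {q : (X × X) × (X × X) | q.1.2 = q.2.1}) := by
    ext p
    constructor
    · rintro ⟨y, hxy, hyz⟩
      exact ⟨((p.1, y), (y, p.2)), ⟨⟨hxy, hyz⟩, rfl⟩, rfl⟩
    · rintro ⟨⟨⟨x, y⟩, ⟨y', z⟩⟩, ⟨⟨hxy, hyz⟩, (rfl : y = y')⟩, rfl⟩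
      exact ⟨y, hxy, hyz⟩
  rw [hcomp]
  refine hmeas.image_of_measurable_injOn (by fun_prop) ?_
  rintro ⟨p, q⟩ ⟨⟨hp, hq⟩, -⟩ ⟨p', q'⟩ ⟨⟨hp', hq'⟩, -⟩ h
  obtain ⟨hfst, hsnd⟩ := Prod.ext_iff.1 h
  exact Prod.ext (hP.injOn_fst hp hp' hfst) (hQ.injOn_snd hq hq' hsnd)

open scoped SetRel in
theorem comp (hP : IsBisection R P) (hQ : IsBisection R Q) : IsBisection R (P ○ Q) where
  measurableSet := hP.measurableSet_comp hQ
  subset_graph := by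
    rintro ⟨x, z⟩ ⟨y, hxy, hyz⟩
    exact R.trans (hP.rel hxy) (hQ.rel hyz)
  injOn_fst := by
    rintro ⟨x, z⟩ ⟨y, hxy, hyz⟩ ⟨_, z'⟩ ⟨y', hxy', hyz'⟩ (rfl : x = _)
    obtain rfl := hP.cod_unique hxy hxy'
    rw [hQ.cod_unique hyz hyz']
  injOn_snd := by
    rintro ⟨x, z⟩ ⟨y, hxy, hyz⟩ ⟨x', _⟩ ⟨y', hxy', hyz'⟩ (rfl : z = _)
    obtain rfl := hQ.dom_unique hyz hyz'
    rw [hP.dom_unique hxy hxy']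

open scoped SetRel in
theorem exists_subset_of_subset_comp (hP : IsBisection R P) (hQ : IsBisection R Q)
    (hV : MeasurableSet V) (hVPQ : V ⊆ P ○ Q) :
    ∃ P' ⊆ P, ∃ Q' ⊆ Q, MeasurableSet P' ∧ MeasurableSet Q' ∧
      SetRel.dom P' = V.dom ∧ SetRel.cod P' = SetRel.dom Q' ∧ SetRel.cod Q' = V.cod := by
  have hVb := (hP.comp hQ).mono hV hVPQ
  refine ⟨P ∩ Prod.fst ⁻¹' V.dom, inter_subset_left, Q ∩ Prod.snd ⁻¹' V.cod, inter_subset_left,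
    hP.measurableSet.inter (measurable_fst hVb.measurableSet_dom),
    hQ.measurableSet.inter (measurable_snd hVb.measurableSet_cod), ?_, ?_, ?_⟩
  · refine Subset.antisymm (fun x ⟨_, h⟩ => h.2) ?_
    rintro x ⟨z, hxz⟩
    obtain ⟨y, hxy, -⟩ := hVPQ hxz
    exact ⟨y, hxy, z, hxz⟩
  · refine Subset.antisymm ?_ ?_
    · rintro y ⟨x, hxy, z, hxz⟩
      obtain ⟨y', hxy', hyz⟩ := hVPQ hxz
      obtain rfl := hP.cod_unique hxy hxy'
      exact ⟨z, hyz, x, hxz⟩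
    · rintro y ⟨z, hyz, x, hxz⟩
      obtain ⟨y', hxy, hyz'⟩ := hVPQ hxz
      obtain rfl := hQ.dom_unique hyz hyz'
      exact ⟨x, hxy, z, hxz⟩
  · refine Subset.antisymm (fun z ⟨_, h⟩ => h.2) ?_
    rintro z ⟨x, hxz⟩
    obtain ⟨y, -, hyz⟩ := hVPQ hxz
    exact ⟨y, hyz, x, hxz⟩

end IsBisection

namespace IsNonsingular

theorem countable_fst_fiber (hR : IsNonsingular R μ) (x : X) :
    ((fun p : graph R => p.1.1) ⁻¹' {x}).Countable := by
  refine MapsTo.countable_of_injOn (t := {y | R x y}) (f := fun p => p.1.2) ?_ ?_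
    (hR.countable_class x)
  · rintro ⟨p, hp⟩ rfl
    exact hp
  · rintro ⟨p, hp⟩ rfl ⟨q, hq⟩ hq' h
    exact Subtype.ext (Prod.ext hq'.symm h)

variable [StandardBorelSpace X]

theorem exists_injOn_fst_cover [SFinite μ] (hR : IsNonsingular R μ) :
    ∃ G : ℕ → SetRel X X, (∀ n, MeasurableSet (G n)) ∧ (∀ n, G n ⊆ graph R) ∧
      (∀ n, InjOn Prod.fst (G n)) ∧ μ (SetRel.dom (graph R \ ⋃ n, G n)) = 0 := by
  have := hR.measurableSet_graph.standardBorel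
  obtain ⟨G, hG, hinj, hnull⟩ := exists_countable_injOn_cover (Z := graph R) μ
    (π := fun p => p.1.1) (by fun_prop) hR.countable_fst_fiber
  refine ⟨fun n => Subtype.val '' G n, fun n => ?_, fun n => Subtype.coe_image_subset _ _,
    fun n => ?_, measure_mono_null ?_ hnull⟩
  · exact (MeasurableEmbedding.subtype_coe hR.measurableSet_graph).measurableSet_image.2 (hG n)
  · rintro _ ⟨p, hp, rfl⟩ _ ⟨q, hq, rfl⟩ h
    rw [hinj n hp hq h]
  · rintro x ⟨y, hxy, hG⟩
    rw [← image_iUnion] at hG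
    exact ⟨⟨(x, y), hxy⟩, fun h => hG ⟨_, h, rfl⟩, rfl⟩

theorem exists_isBisection_cover [SFinite μ] (hR : IsNonsingular R μ) :
    ∃ Q : ℕ → SetRel X X, (∀ n, IsBisection R (Q n)) ∧
      μ (SetRel.dom (graph R \ ⋃ n, Q n)) = 0 := by
  obtain ⟨G, hG, hsub, hinj, hnull⟩ := hR.exists_injOn_fst_cover
  refine ⟨fun i => G i.unpair.1 ∩ (G i.unpair.2).inv, fun i => ⟨?_, ?_, ?_, ?_⟩,
    measure_mono_null ?_ (measure_union_null hnull (hR.saturation_null _ hnull))⟩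
  · exact (hG _).inter (measurable_swap (hG _))
  · exact inter_subset_left.trans (hsub _)
  · exact (hinj _).mono inter_subset_left
  · exact (injOn_snd_iff_injOn_fst_inv.2 (hinj _)).mono inter_subset_right
  rintro x ⟨y, hxy, hQ⟩
  by_cases h₁ : (x, y) ∈ ⋃ n, G n
  · by_cases h₂ : (y, x) ∈ ⋃ n, G n
    · obtain ⟨n, hn⟩ := mem_iUnion.1 h₁
      obtain ⟨m, hm⟩ := mem_iUnion.1 h₂
      refine absurd (mem_iUnion.2 ⟨Nat.pair n m, ?_⟩) hQ
      rw [Nat.unpair_pair]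
      exact ⟨hn, hm⟩
    · exact Or.inr ⟨y, ⟨x, R.symm hxy, h₂⟩, R.symm hxy⟩
  · exact Or.inl ⟨y, hxy, h₁⟩

theorem exists_isSectionPartition [SFinite μ] (hR : IsNonsingular R μ) :
    ∃ P : ℕ → SetRel X X, (∀ k, IsBisection R (P k)) ∧
      IsSectionPartition Prod.fst (graph R) μ P ∧ IsSectionPartition Prod.snd (graph R) μ P := by
  obtain ⟨Q, hQ, hnull⟩ := hR.exists_isBisection_cover
  have hP (k : ℕ) : IsBisection R (disjointed Q k) :=
    (hQ k).mono (MeasurableSet.disjointed (fun i => (hQ i).measurableSet) k)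
      (disjointed_subset Q k)
  rw [← iUnion_disjointed] at hnull
  refine ⟨disjointed Q, hP, ⟨fun k => (hP k).measurableSet, fun k => (hP k).subset_graph,
    disjoint_disjointed Q, fun k => (hP k).injOn_fst, ?_⟩,
    ⟨fun k => (hP k).measurableSet, fun k => (hP k).subset_graph,
    disjoint_disjointed Q, fun k => (hP k).injOn_snd, ?_⟩⟩
  · rwa [image_fst_eq_dom]
  · rw [image_snd_eq_cod]
    exact hR.measure_cod_eq_zero sdiff_subset hnull

end IsNonsingular

end Bisections

section Modulus

theorem IsNonsingular.of_measureClass (hR : IsNonsingular R μ) (hν : ν ∈ measureClass μ) :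
    IsNonsingular R ν :=
  ⟨hR.measurableSet_graph, hR.countable_class, fun N hN =>
    hν.2.1 (hR.saturation_null N (hν.2.2 hN))⟩

theorem measurable_modulus (R : Setoid X) (μ : Measure X) : Measurable (modulus R μ) :=
  (Measure.measurable_rnDeriv _ _).ennreal_toReal

variable [StandardBorelSpace X]

namespace IsNonsingular

theorem leftMeasure_apply [SFinite μ] (hR : IsNonsingular R μ) (hW : IsBisection R W) :
    leftMeasure R μ W = μ W.dom := by
  obtain ⟨P, -, hP, -⟩ := hR.exists_isSectionPartition
  rw [← image_fst_eq_dom]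
  exact hP.fiberCounting_apply_of_injOn measurable_fst hW.measurableSet hW.subset_graph
    hW.injOn_fst

theorem rightMeasure_apply [SFinite μ] (hR : IsNonsingular R μ) (hW : IsBisection R W) :
    rightMeasure R μ W = μ W.cod := by
  obtain ⟨P, -, -, hP⟩ := hR.exists_isSectionPartition
  rw [← image_snd_eq_cod]
  exact hP.fiberCounting_apply_of_injOn measurable_snd hW.measurableSet hW.subset_graph
    hW.injOn_snd

theorem exists_isBisection_subset [SFinite μ] (hR : IsNonsingular R μ) (hW : MeasurableSet W)
    (h : rightMeasure R μ W ≠ 0) : ∃ V ⊆ W, IsBisection R V ∧ μ (SetRel.cod V) ≠ 0 := by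
  obtain ⟨P, hPb, -, hP⟩ := hR.exists_isSectionPartition
  have hsum : rightMeasure R μ W = ∑' k, μ (Prod.snd '' (W ∩ P k)) :=
    hP.fiberCounting_apply measurable_snd hW
  rw [hsum, Ne, ENNReal.tsum_eq_zero, not_forall] at h
  obtain ⟨k, hk⟩ := h
  exact ⟨W ∩ P k, inter_subset_left,
    (hPb k).mono (hW.inter (hPb k).measurableSet) inter_subset_right,
    by rwa [image_snd_eq_cod] at hk⟩

theorem rightMeasure_eq_zero_iff [SFinite μ] (hR : IsNonsingular R μ) (hW : MeasurableSet W)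
    (hWR : W ⊆ graph R) : rightMeasure R μ W = 0 ↔ μ W.dom = 0 := by
  obtain ⟨P, -, -, hP⟩ := hR.exists_isSectionPartition
  rw [hR.measure_dom_eq_zero_iff hWR, ← image_snd_eq_cod]
  exact hP.fiberCounting_eq_zero_iff measurable_snd hW hWR

theorem leftMeasure_eq_zero_iff [SFinite μ] (hR : IsNonsingular R μ) (hW : MeasurableSet W) :
    leftMeasure R μ W = 0 ↔ rightMeasure R μ W = 0 := by
  obtain ⟨P, hPb, hfst, hsnd⟩ := hR.exists_isSectionPartition
  have hl : leftMeasure R μ W = ∑' k, μ (Prod.fst '' (W ∩ P k)) :=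
    hfst.fiberCounting_apply measurable_fst hW
  have hr : rightMeasure R μ W = ∑' k, μ (Prod.snd '' (W ∩ P k)) :=
    hsnd.fiberCounting_apply measurable_snd hW
  rw [hl, hr, ENNReal.tsum_eq_zero, ENNReal.tsum_eq_zero]
  simp only [image_fst_eq_dom, image_snd_eq_cod]
  exact forall_congr' fun k =>
    hR.measure_dom_eq_zero_iff (inter_subset_right.trans (hPb k).subset_graph)

theorem sigmaFinite_leftMeasure [SigmaFinite μ] (hR : IsNonsingular R μ) :
    SigmaFinite (leftMeasure R μ) :=
  let ⟨_, _, hP, _⟩ := hR.exists_isSectionPartition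
  hP.sigmaFinite_fiberCounting measurable_fst

theorem sigmaFinite_rightMeasure [SigmaFinite μ] (hR : IsNonsingular R μ) :
    SigmaFinite (rightMeasure R μ) :=
  let ⟨_, _, _, hP⟩ := hR.exists_isSectionPartition
  hP.sigmaFinite_fiberCounting measurable_snd

variable [SigmaFinite μ]

theorem leftMeasure_eq_setLIntegral (hR : IsNonsingular R μ) (W : SetRel X X) :
    leftMeasure R μ W = ∫⁻ p in W, ENNReal.ofReal (modulus R μ p) ∂(rightMeasure R μ) := by
  have := hR.sigmaFinite_leftMeasure
  have := hR.sigmaFinite_rightMeasure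
  have hac : leftMeasure R μ ≪ rightMeasure R μ :=
    Measure.AbsolutelyContinuous.mk fun _ hs => (hR.leftMeasure_eq_zero_iff hs).2
  rw [← Measure.setLIntegral_rnDeriv hac W]
  refine lintegral_congr_ae (ae_restrict_of_ae ?_)
  filter_upwards [Measure.rnDeriv_lt_top (leftMeasure R μ) (rightMeasure R μ)] with p hp
  exact (ENNReal.ofReal_toReal hp.ne).symm

theorem ae_modulus_pos (hR : IsNonsingular R μ) :
    ∀ᵐ p ∂(rightMeasure R μ), 0 < modulus R μ p := by
  have hm : MeasurableSet {p | modulus R μ p ≤ 0} :=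
    measurableSet_le (measurable_modulus R μ) measurable_const
  have hnull : rightMeasure R μ {p | modulus R μ p ≤ 0} = 0 := by
    rw [← hR.leftMeasure_eq_zero_iff hm, hR.leftMeasure_eq_setLIntegral,
      setLIntegral_congr_fun (g := 0) hm fun p hp => ENNReal.ofReal_of_nonpos hp]
    exact lintegral_zero
  simpa only [ae_iff, not_lt] using hnull

end IsNonsingular

end Modulus

/-- The partial isomorphism with graph `W` multiplies measures by a factor in `[a, b]`: the image
of a set of `ν₁`-measure `t` has `ν₂`-measure between `a * t` and `b * t`. For a bisection `W` this
encodes bounds on the Radon–Nikodym derivative without mentioning it. -/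
def HasRatio (ν₁ ν₂ : Measure X) (a b : ENNReal) (W : SetRel X X) : Prop :=
  ∀ V : SetRel X X, V ⊆ W → MeasurableSet V →
    a * ν₁ V.dom ≤ ν₂ V.cod ∧ ν₂ V.cod ≤ b * ν₁ V.dom

namespace HasRatio

variable {ν₁ ν₂ ν₃ : Measure X} {a b a' b' : ENNReal}

theorem mono (h : HasRatio ν₁ ν₂ a b W) (hVW : V ⊆ W) : HasRatio ν₁ ν₂ a b V :=
  fun U hU hUm => h U (hU.trans hVW) hUm

theorem weaken (h : HasRatio ν₁ ν₂ a b W) (ha : a' ≤ a) (hb : b ≤ b') :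
    HasRatio ν₁ ν₂ a' b' W :=
  fun U hU hUm => ⟨(mul_le_mul_left ha _).trans (h U hU hUm).1,
    (h U hU hUm).2.trans (mul_le_mul_left hb _)⟩

theorem inv (h : HasRatio ν₁ ν₂ a b W) (ha : a ≠ 0) (ha' : a ≠ ⊤) :
    HasRatio ν₂ ν₁ b⁻¹ a⁻¹ W.inv := by
  intro V hV hVm
  obtain ⟨hlower, hupper⟩ := h V.inv (SetRel.inv_mono hV) (measurable_swap hVm)
  refine ⟨?_, (ENNReal.mul_le_iff_le_inv ha ha').1 hlower⟩
  rw [mul_comm, ← div_eq_mul_inv]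
  exact ENNReal.div_le_of_le_mul' hupper

theorem of_modulus [StandardBorelSpace X] [SigmaFinite μ] (hR : IsNonsingular R μ)
    (hW : IsBisection R W) {c d : ℝ} (hcd : ∀ p ∈ W, modulus R μ p ∈ Icc c d) :
    HasRatio μ μ (ENNReal.ofReal c) (ENNReal.ofReal d) W.inv := by
  intro V hVW hV
  have hV' : IsBisection R V.inv := (hW.inv.mono hV hVW).inv
  have hmod (p) (hp : p ∈ V.inv) : modulus R μ p ∈ Icc c d := hcd p (SetRel.inv_mono hVW hp)
  rw [← SetRel.cod_inv (R := V), ← SetRel.dom_inv (R := V), ← hR.leftMeasure_apply hV',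
    ← hR.rightMeasure_apply hV', hR.leftMeasure_eq_setLIntegral, ← setLIntegral_const,
    ← setLIntegral_const]
  exact ⟨setLIntegral_mono' hV'.measurableSet fun p hp => ENNReal.ofReal_le_ofReal (hmod p hp).1,
    setLIntegral_mono' hV'.measurableSet fun p hp => ENNReal.ofReal_le_ofReal (hmod p hp).2⟩

variable [StandardBorelSpace X]

open scoped SetRel in
theorem comp (hP : IsBisection R P) (hQ : IsBisection R Q) (h : HasRatio ν₁ ν₂ a b P)
    (h' : HasRatio ν₂ ν₃ a' b' Q) : HasRatio ν₁ ν₃ (a' * a) (b' * b) (P ○ Q) := by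
  intro V hVPQ hV
  obtain ⟨P', hP', Q', hQ', hP'm, hQ'm, hdom, hmid, hcod⟩ :=
    hP.exists_subset_of_subset_comp hQ hV hVPQ
  obtain ⟨hlower, hupper⟩ := h P' hP' hP'm
  obtain ⟨hlower', hupper'⟩ := h' Q' hQ' hQ'm
  rw [hdom, hmid] at hlower hupper
  rw [hcod] at hlower' hupper'
  rw [mul_assoc, mul_assoc]
  exact ⟨(mul_le_mul_right hlower a').trans hlower', hupper'.trans (mul_le_mul_right hupper b')⟩

theorem iUnion [Countable ι] {W : ι → SetRel X X} (hW : ∀ i, IsBisection R (W i))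
    (hdom : Pairwise (Function.onFun Disjoint fun i => (W i).dom))
    (hcod : Pairwise (Function.onFun Disjoint fun i => (W i).cod))
    (h : ∀ i, HasRatio ν₁ ν₂ a b (W i)) : HasRatio ν₁ ν₂ a b (⋃ i, W i) := by
  intro V hV hVm
  have hVi (i : ι) : IsBisection R (V ∩ W i) :=
    (hW i).mono (hVm.inter (hW i).measurableSet) inter_subset_right
  have hVeq : V = ⋃ i, V ∩ W i := by rw [← inter_iUnion, inter_eq_left.2 hV]
  have hV₁ : ν₁ V.dom = ∑' i, ν₁ (SetRel.dom (V ∩ W i)) := by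
    conv_lhs => rw [hVeq, dom_iUnion]
    exact measure_iUnion (fun i j hij => (hdom hij).mono (SetRel.dom_mono inter_subset_right)
      (SetRel.dom_mono inter_subset_right)) fun i => (hVi i).measurableSet_dom
  have hV₂ : ν₂ V.cod = ∑' i, ν₂ (SetRel.cod (V ∩ W i)) := by
    conv_lhs => rw [hVeq, cod_iUnion]
    exact measure_iUnion (fun i j hij => (hcod hij).mono (SetRel.cod_mono inter_subset_right)
      (SetRel.cod_mono inter_subset_right)) fun i => (hVi i).measurableSet_cod
  rw [hV₁, hV₂, ← ENNReal.tsum_mul_left, ← ENNReal.tsum_mul_left]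
  exact ⟨ENNReal.tsum_le_tsum fun i => (h i _ inter_subset_right (hVi i).measurableSet).1,
    ENNReal.tsum_le_tsum fun i => (h i _ inter_subset_right (hVi i).measurableSet).2⟩

theorem union (hV : IsBisection R V) (hW : IsBisection R W) (hdom : Disjoint V.dom W.dom)
    (hcod : Disjoint V.cod W.cod) (h : HasRatio ν₁ ν₂ a b V) (h' : HasRatio ν₁ ν₂ a b W) :
    HasRatio ν₁ ν₂ a b (V ∪ W) := by
  rw [union_eq_iUnion]
  refine iUnion (R := R) (Bool.forall_bool.2 ⟨hW, hV⟩) ?_ ?_ (Bool.forall_bool.2 ⟨h', h⟩)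
  · simpa only [Bool.apply_cond SetRel.dom] using pairwise_disjoint_on_bool.2 hdom
  · simpa only [Bool.apply_cond SetRel.cod] using pairwise_disjoint_on_bool.2 hcod

end HasRatio

section Transport

theorem IsNonsingular.exists_measure_dom_inter_prod_ne_zero [Countable ι]
    (hR : IsNonsingular R μ) (hWR : W ⊆ graph R) (hW : μ W.dom ≠ 0) {D : ι → Set X}
    (hD : μ (⋃ i, D i)ᶜ = 0) : ∃ i j, μ (SetRel.dom (W ∩ D i ×ˢ D j)) ≠ 0 := by
  by_contra! hnull
  refine hW (measure_mono_null ?_ (measure_union_null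
    (measure_iUnion_null fun i => measure_iUnion_null (hnull i))
    (measure_union_null hD (hR.saturation_null _ hD))))
  rintro x ⟨y, hxy⟩
  by_cases hx : x ∈ ⋃ i, D i
  · by_cases hy : y ∈ ⋃ i, D i
    · obtain ⟨i, hi⟩ := mem_iUnion.1 hx
      obtain ⟨j, hj⟩ := mem_iUnion.1 hy
      exact Or.inl (mem_iUnion₂.2 ⟨i, j, y, hxy, hi, hj⟩)
    · exact Or.inr (Or.inr ⟨y, hy, R.symm (hWR hxy)⟩)
  · exact Or.inr (Or.inl hx)

/-- The pull-back of `μ` along the map with graph `T ⊆ R`: each injective piece of the map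
preserves measure, and the total mass counts points of the range with multiplicity. -/
noncomputable def pullbackMeasure (R : Setoid X) (μ : Measure X) (T : SetRel X X) : Measure X :=
  ((rightMeasure R μ).restrict T).map Prod.fst

theorem pullbackMeasure_apply (R : Setoid X) (μ : Measure X) (T : SetRel X X) {E : Set X}
    (hE : MeasurableSet E) :
    pullbackMeasure R μ T E = rightMeasure R μ (Prod.fst ⁻¹' E ∩ T) := by
  rw [pullbackMeasure, Measure.map_apply measurable_fst hE,
    Measure.restrict_apply (measurable_fst hE)]

variable [StandardBorelSpace X]

theorem IsErgodic.ae_exists_rel [SFinite μ] (hErg : IsErgodic R μ) (hR : IsNonsingular R μ)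
    {A : Set X} (hA : MeasurableSet A) (hA0 : μ A ≠ 0) : ∀ᵐ x ∂μ, ∃ y ∈ A, R x y := by
  set S : Set X := {x | ∃ y ∈ A, R x y}
  have hSm : NullMeasurableSet S μ := by
    have hproj : S = Prod.fst '' (graph R ∩ Prod.snd ⁻¹' A) := by
      rw [image_fst_eq_dom]
      exact Subset.antisymm (fun x ⟨y, hy, hxy⟩ => ⟨y, hxy, hy⟩) fun x ⟨y, hxy, hy⟩ => ⟨y, hy, hxy⟩
    rw [hproj]
    exact nullMeasurableSet_image μ measurable_fst
      (hR.measurableSet_graph.inter (measurable_snd hA))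
  have hinv {x y : X} (hxy : R x y) : x ∈ S ↔ y ∈ S :=
    ⟨fun ⟨z, hz, hxz⟩ => ⟨z, hz, R.trans (R.symm hxy) hxz⟩,
      fun ⟨z, hz, hyz⟩ => ⟨z, hz, R.trans hxy hyz⟩⟩
  have hbound (x : X) : ‖S.indicator (fun _ => (1 : ℂ)) x‖ ≤ 1 := by
    refine (norm_indicator_le_norm_self _ x).trans ?_
    rw [norm_one]
  obtain ⟨c, hc⟩ := hErg (S.indicator fun _ => 1)
    (memLp_top_of_bound (aestronglyMeasurable_const.indicator₀ hSm) 1 (ae_of_all _ hbound))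
    (ae_of_all _ fun x y hxy => by classical simp only [indicator_apply, hinv hxy])
  obtain ⟨x, hxA, hx⟩ : ∃ x ∈ A, S.indicator (fun _ => (1 : ℂ)) x = c := by
    by_contra! h
    exact hA0 (measure_mono_null (fun x hx => h x hx) (ae_iff.1 hc))
  rw [indicator_of_mem (show x ∈ S from ⟨x, hxA, R.refl x⟩)] at hx
  filter_upwards [hc] with z hz
  by_contra hzS
  rw [indicator_of_notMem (show z ∉ S from hzS), ← hx] at hz
  exact zero_ne_one hz

theorem IsErgodic.exists_isBisection_into [SFinite μ] (hErg : IsErgodic R μ)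
    (hR : IsNonsingular R μ) {A : Set X} (hA : MeasurableSet A) (hA0 : μ A ≠ 0) :
    ∃ Q : ℕ → SetRel X X, (∀ k, IsBisection R (Q k)) ∧
      Pairwise (Function.onFun Disjoint fun k => (Q k).dom) ∧
      (∀ k, (Q k).cod ⊆ A) ∧ μ (⋃ k, (Q k).dom)ᶜ = 0 := by
  obtain ⟨P, hP, hnull⟩ := hR.exists_isBisection_cover
  set E : ℕ → Set X := fun k => SetRel.dom (P k ∩ univ ×ˢ A)
  have hEm (k : ℕ) : MeasurableSet (E k) :=
    ((hP k).mono ((hP k).measurableSet.inter (MeasurableSet.univ.prod hA))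
      inter_subset_left).measurableSet_dom
  have hdom (k : ℕ) : SetRel.dom (P k ∩ disjointed E k ×ˢ A) = disjointed E k := by
    refine Subset.antisymm (fun x ⟨_, h⟩ => h.2.1) fun x hx => ?_
    obtain ⟨y, hxy, -, hy⟩ := disjointed_subset E k hx
    exact ⟨y, hxy, hx, hy⟩
  refine ⟨fun k => P k ∩ disjointed E k ×ˢ A, fun k => ?_, ?_, fun k y ⟨_, h⟩ => h.2.2, ?_⟩
  · exact (hP k).mono ((hP k).measurableSet.inter
      ((MeasurableSet.disjointed hEm k).prod hA)) inter_subset_left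
  · simp only [hdom]
    exact disjoint_disjointed E
  · simp only [hdom, iUnion_disjointed]
    refine measure_mono_null (fun x hx => ?_)
      (measure_union_null hnull (ae_iff.1 (hErg.ae_exists_rel hR hA hA0)))
    refine or_iff_not_imp_right.2 fun hxA => ?_
    obtain ⟨y, hy, hxy⟩ := not_not.1 hxA
    refine ⟨y, hxy, fun hxP => hx ?_⟩
    obtain ⟨k, hk⟩ := mem_iUnion.1 hxP
    exact mem_iUnion.2 ⟨k, y, hk, mem_univ x, hy⟩

theorem pullbackMeasure_dom [SFinite μ] {T : SetRel X X} (hR : IsNonsingular R μ)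
    (hT : InjOn Prod.fst T) (hV : IsBisection R V) (hVT : V ⊆ T) :
    pullbackMeasure R μ T V.dom = μ V.cod := by
  rw [pullbackMeasure_apply _ _ _ hV.measurableSet_dom, ← hR.rightMeasure_apply hV]
  congr 1
  refine Subset.antisymm ?_ fun p hp => ⟨⟨p.2, hp⟩, hVT hp⟩
  rintro p ⟨⟨y, hy⟩, hp⟩
  rwa [← hT (hVT hy) hp rfl]

theorem pullbackMeasure_eq_zero_iff [SFinite μ] {T : SetRel X X} (hR : IsNonsingular R μ)
    (hT : MeasurableSet T) (hTR : T ⊆ graph R) (hfull : μ T.domᶜ = 0) {E : Set X}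
    (hE : MeasurableSet E) :
    pullbackMeasure R μ T E = 0 ↔ μ E = 0 := by
  have hdom : SetRel.dom (Prod.fst ⁻¹' E ∩ T) = E ∩ T.dom :=
    Subset.antisymm (fun x ⟨y, hx, hxy⟩ => ⟨hx, y, hxy⟩) fun x ⟨hx, y, hxy⟩ => ⟨y, hx, hxy⟩
  rw [pullbackMeasure_apply _ _ _ hE, hR.rightMeasure_eq_zero_iff
    ((measurable_fst hE).inter hT) (inter_subset_right.trans hTR), hdom,
    measure_inter_conull hfull]

theorem sigmaFinite_pullbackMeasure [SigmaFinite μ] (hR : IsNonsingular R μ) {Q : ℕ → SetRel X X}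
    (hQ : ∀ k, IsBisection R (Q k))
    (hdisj : Pairwise (Function.onFun Disjoint fun k => (Q k).dom))
    (hfull : μ (⋃ k, (Q k).dom)ᶜ = 0) :
    SigmaFinite (pullbackMeasure R μ (⋃ k, Q k)) := by
  let D (i : ℕ × ℕ) : SetRel X X := Q i.1 ∩ univ ×ˢ spanningSets μ i.2
  have hD (i : ℕ × ℕ) : IsBisection R (D i) :=
    (hQ i.1).mono ((hQ i.1).measurableSet.inter
      (MeasurableSet.univ.prod (measurableSet_spanningSets μ i.2))) inter_subset_left
  have hcover : ⋃ k, (Q k).dom ⊆ ⋃ i, (D i).dom := by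
    rintro x hx
    obtain ⟨k, y, hxy⟩ := mem_iUnion.1 hx
    exact mem_iUnion.2
      ⟨(k, spanningSetsIndex μ y), y, hxy, mem_univ x, mem_spanningSetsIndex μ y⟩
  refine Measure.sigmaFinite_of_countable
    (S := insert (⋃ k, (Q k).dom)ᶜ (range fun i => (D i).dom))
    ((countable_range _).insert _) (forall_mem_insert.2 ⟨?_, forall_mem_range.2 fun i => ?_⟩) ?_
  · rw [(pullbackMeasure_eq_zero_iff hR (MeasurableSet.iUnion fun k => (hQ k).measurableSet)
      (iUnion_subset fun k => (hQ k).subset_graph) (by rwa [dom_iUnion])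
      (MeasurableSet.iUnion fun k => (hQ k).measurableSet_dom).compl).2 hfull]
    exact ENNReal.zero_lt_top
  · rw [pullbackMeasure_dom hR (IsBisection.injOn_fst_iUnion hQ hdisj) (hD i)
      (inter_subset_left.trans (subset_iUnion Q i.1))]
    have hcod : (D i).cod ⊆ spanningSets μ i.2 := fun y ⟨_, h⟩ => h.2.2
    exact (measure_mono hcod).trans_lt (measure_spanningSets_lt_top μ i.2)
  · rw [sUnion_insert, sUnion_range, ← univ_subset_iff, ← compl_union_self (⋃ k, (Q k).dom)]
    exact union_subset_union_right _ hcover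

theorem exists_mem_measureClass_hasRatio_one [SigmaFinite μ] (hR : IsNonsingular R μ)
    {Q : ℕ → SetRel X X} (hQ : ∀ k, IsBisection R (Q k))
    (hdisj : Pairwise (Function.onFun Disjoint fun k => (Q k).dom))
    (hfull : μ (⋃ k, (Q k).dom)ᶜ = 0) :
    ∃ ν ∈ measureClass μ, ∀ k, HasRatio ν μ 1 1 (Q k) := by
  have hnull {E : Set X} (hE : MeasurableSet E) :
      pullbackMeasure R μ (⋃ k, Q k) E = 0 ↔ μ E = 0 :=
    pullbackMeasure_eq_zero_iff hR (MeasurableSet.iUnion fun k => (hQ k).measurableSet)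
      (iUnion_subset fun k => (hQ k).subset_graph) (by rwa [dom_iUnion]) hE
  refine ⟨pullbackMeasure R μ (⋃ k, Q k), ⟨sigmaFinite_pullbackMeasure hR hQ hdisj hfull,
    Measure.AbsolutelyContinuous.mk fun E hE => (hnull hE).2,
    Measure.AbsolutelyContinuous.mk fun E hE => (hnull hE).1⟩, fun k V hV hVm => ?_⟩
  rw [one_mul, pullbackMeasure_dom hR (IsBisection.injOn_fst_iUnion hQ hdisj)
    ((hQ k).mono hVm hV) (hV.trans (subset_iUnion Q k))]
  exact ⟨le_rfl, le_rfl⟩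

theorem exists_hasRatio_of_mem_essRangeModulus [SigmaFinite μ] (hR : IsNonsingular R μ)
    {t c d : ℝ} (ht : t ∈ essRangeModulus R μ) (hct : c < t) (htd : t < d) :
    ∃ W, IsBisection R W ∧ μ W.dom ≠ 0 ∧
      HasRatio μ μ (ENNReal.ofReal c) (ENNReal.ofReal d) W := by
  have hpos := (Measure.mem_support_iff_forall t).1 ht (Ioo c d) (Ioo_mem_nhds hct htd)
  rw [Measure.map_apply (measurable_modulus R μ) measurableSet_Ioo] at hpos
  obtain ⟨V, hVsub, hV, hV0⟩ := hR.exists_isBisection_subset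
    (measurable_modulus R μ measurableSet_Ioo) hpos.ne'
  exact ⟨V.inv, hV.inv, hV0,
    .of_modulus hR hV fun p hp => Ioo_subset_Icc_self (hVsub hp)⟩

open scoped SetRel in
theorem exists_hasRatio_of_mem_SInvariant [SigmaFinite μ] (hR : IsNonsingular R μ)
    (hErg : IsErgodic R μ) {t c d : ℝ} (ht : t ∈ SInvariant R μ) (hct : c < t) (htd : t < d)
    {A : Set X} (hA : MeasurableSet A) (hA0 : μ A ≠ 0) :
    ∃ V ⊆ A ×ˢ A, IsBisection R V ∧ μ (SetRel.dom V) ≠ 0 ∧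
      HasRatio μ μ (ENNReal.ofReal c) (ENNReal.ofReal d) V := by
  obtain ⟨Q, hQ, hdisj, hQA, hfull⟩ := hErg.exists_isBisection_into hR hA hA0
  obtain ⟨ν, hν, hone⟩ := exists_mem_measureClass_hasRatio_one hR hQ hdisj hfull
  have : SigmaFinite ν := hν.1
  obtain ⟨W, hW, hW0, hWratio⟩ := exists_hasRatio_of_mem_essRangeModulus
    (hR.of_measureClass hν) (mem_iInter₂.1 ht ν hν) hct htd
  obtain ⟨i, j, hij⟩ := hR.exists_measure_dom_inter_prod_ne_zero hW.subset_graph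
    (fun h => hW0 (hν.2.1 h)) hfull
  set W' := W ∩ (Q i).dom ×ˢ (Q j).dom
  have hW'b : IsBisection R W' := hW.mono (hW.measurableSet.inter
    ((hQ i).measurableSet_dom.prod (hQ j).measurableSet_dom)) inter_subset_left
  have hVb := ((hQ i).inv.comp hW'b).comp (hQ j)
  refine ⟨((Q i).inv ○ W') ○ Q j, ?_, hVb, fun h0 => hij ?_, ?_⟩
  · rintro ⟨a, b⟩ ⟨y, ⟨x, hxa, -⟩, hyb⟩
    exact ⟨hQA i ⟨x, hxa⟩, hQA j ⟨y, hyb⟩⟩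
  · refine measure_mono_null ?_ (hR.saturation_null _ h0)
    rintro x ⟨y, hxy, ⟨a, hxa⟩, ⟨b, hyb⟩⟩
    exact ⟨a, ⟨b, y, ⟨x, hxa, hxy, ⟨a, hxa⟩, ⟨b, hyb⟩⟩, hyb⟩, R.symm ((hQ i).rel hxa)⟩
  · simpa only [inv_one, mul_one, one_mul] using HasRatio.comp ((hQ i).inv.comp hW'b) (hQ j)
      (HasRatio.comp (hQ i).inv hW'b ((hone i).inv one_ne_zero ENNReal.one_ne_top)
        (hWratio.mono inter_subset_left)) (hone j)

end Transport

/-- Up to the factor `C`, every ratio `m > 0` is realized by partial isomorphisms between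
parts of any two nonnull sets. -/
def HasLocalRatios (R : Setoid X) (μ : Measure X) (C : ℝ) : Prop :=
  ∀ m : ℝ, 0 < m → ∀ A B : Set X, MeasurableSet A → MeasurableSet B → μ A ≠ 0 → μ B ≠ 0 →
    ∃ V ⊆ A ×ˢ B, IsBisection R V ∧ μ (SetRel.dom V) ≠ 0 ∧
      HasRatio μ μ (ENNReal.ofReal (C * m)) (ENNReal.ofReal m) V

section LocalRatios

theorem exists_forall_zpow_mem {C s : ℝ} (hC : 0 < C) (hCs : C < s) (hs1 : s < 1) :
    ∃ g : ℝ, 1 < g ∧ ∀ r : ℝ, 0 < r → ∃ n : ℤ, C * r * g ≤ s ^ n ∧ s ^ n * g ^ 2 ≤ r := by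
  have hs0 : 0 < s := hC.trans hCs
  have hsC : 1 < s / C := (one_lt_div hC).2 hCs
  set g : ℝ := (s / C) ^ ((3 : ℕ)⁻¹ : ℝ)
  have hg0 : 0 < g := by positivity
  have hg3 : g ^ 3 = s / C := Real.rpow_inv_natCast_pow (by positivity) three_ne_zero
  refine ⟨g, Real.one_lt_rpow hsC (by positivity), fun r hr => ?_⟩
  obtain ⟨k, hlower, hupper⟩ := exists_mem_Ico_zpow (x := r / g ^ 2) (y := s⁻¹) (by positivity)
    ((one_lt_inv₀ hs0).2 hs1)
  rw [zpow_add_one₀ (inv_ne_zero hs0.ne'), inv_zpow', ← div_eq_mul_inv, lt_div_iff₀ hs0] at hupper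
  rw [inv_zpow', le_div_iff₀ (by positivity)] at hlower
  refine ⟨-k, ?_, hlower⟩
  calc C * r * g = r / g ^ 2 * s := by
        rw [(div_eq_iff hC.ne').1 hg3.symm]
        field_simp
    _ ≤ s ^ (-k) := hupper.le

theorem IsTypeIIIParam.exists_zpow_mem_SInvariant {l C : ℝ} (hType : IsTypeIIIParam R μ l)
    (hC : 0 < C) (hCl : C < l) : ∃ s, C < s ∧ s < 1 ∧ ∀ n : ℤ, s ^ n ∈ SInvariant R μ := by
  rcases hType.2 with ⟨-, hl1, hS⟩ | ⟨rfl, hS⟩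
  · exact ⟨l, hCl, hl1, fun n => hS ▸ Or.inr ⟨n, rfl⟩⟩
  · obtain ⟨s, hCs, hs1⟩ := exists_between hCl
    exact ⟨s, hCs, hs1, fun n => hS ▸ mem_Ici.2 (zpow_nonneg (hC.trans hCs).le n)⟩

variable [StandardBorelSpace X]

theorem IsErgodic.rightMeasure_prod_ne_zero [SFinite μ] (hErg : IsErgodic R μ)
    (hR : IsNonsingular R μ) {A B : Set X} (hA : MeasurableSet A) (hB : MeasurableSet B)
    (hA0 : μ A ≠ 0) (hB0 : μ B ≠ 0) : rightMeasure R μ (graph R ∩ A ×ˢ B) ≠ 0 := by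
  rw [Ne, hR.rightMeasure_eq_zero_iff (hR.measurableSet_graph.inter (hA.prod hB))
    inter_subset_left]
  intro h
  refine hA0 (measure_mono_null (fun x hx => ?_)
    (measure_union_null h (ae_iff.1 (hErg.ae_exists_rel hR hB hB0))))
  refine or_iff_not_imp_right.2 fun hxB => ?_
  obtain ⟨y, hy, hxy⟩ := not_not.1 hxB
  exact ⟨y, hxy, hx, hy⟩

variable [SigmaFinite μ]

theorem IsErgodic.exists_hasRatio_zpow (hErg : IsErgodic R μ) (hR : IsNonsingular R μ) {g : ℝ}
    (hg : 1 < g) {A B : Set X} (hA : MeasurableSet A) (hB : MeasurableSet B) (hA0 : μ A ≠ 0)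
    (hB0 : μ B ≠ 0) : ∃ j : ℤ, ∃ V ⊆ A ×ˢ B, IsBisection R V ∧ μ (SetRel.dom V) ≠ 0 ∧
      HasRatio μ μ (ENNReal.ofReal (g ^ j)) (ENNReal.ofReal (g ^ j * g)) V := by
  set M : SetRel X X := graph R ∩ B ×ˢ A
  set J : ℤ → SetRel X X := fun j => modulus R μ ⁻¹' Ico (g ^ j) (g ^ j * g)
  have hM : MeasurableSet M := hR.measurableSet_graph.inter (hB.prod hA)
  have hJm (j : ℤ) : MeasurableSet (J j) := measurable_modulus R μ measurableSet_Ico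
  obtain ⟨j, hj⟩ : ∃ j, rightMeasure R μ (M ∩ J j) ≠ 0 := by
    by_contra! h
    refine hErg.rightMeasure_prod_ne_zero hR hB hA hB0 hA0 (measure_mono_null (fun p hp => ?_)
      (measure_union_null (measure_iUnion_null h) (ae_iff.1 hR.ae_modulus_pos)))
    refine or_iff_not_imp_right.2 fun hpos => ?_
    obtain ⟨j, hj⟩ := exists_mem_Ico_zpow (not_not.1 hpos) hg
    rw [zpow_add_one₀ (zero_lt_one.trans hg).ne'] at hj
    exact mem_iUnion.2 ⟨j, hp, hj⟩
  obtain ⟨V, hVsub, hV, hV0⟩ := hR.exists_isBisection_subset (hM.inter (hJm j)) hj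
  exact ⟨j, V.inv, fun p hp => (hVsub hp).1.2.symm, hV.inv, hV0,
    .of_modulus hR hV fun p hp => Ico_subset_Icc_self (hVsub hp).2⟩

open scoped SetRel in
theorem IsErgodic.hasLocalRatios (hErg : IsErgodic R μ) (hR : IsNonsingular R μ) {C s : ℝ}
    (hC : 0 < C) (hCs : C < s) (hs1 : s < 1) (hsS : ∀ n : ℤ, s ^ n ∈ SInvariant R μ) :
    HasLocalRatios R μ C := by
  intro m hm A B hA hB hA0 hB0
  obtain ⟨g, hg1, hg⟩ := exists_forall_zpow_mem hC hCs hs1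
  have hg0 : 0 < g := zero_lt_one.trans hg1
  obtain ⟨j, W, hWAB, hW, hW0, hWratio⟩ := hErg.exists_hasRatio_zpow hR hg1 hA hB hA0 hB0
  set γ : ℝ := g ^ j
  have hγ0 : 0 < γ := zpow_pos hg0 j
  obtain ⟨n, hlower, hupper⟩ := hg (m / γ) (by positivity)
  have hsn : 0 < s ^ n := zpow_pos (hC.trans hCs) n
  obtain ⟨V, hVW, hV, hV0, hVratio⟩ := exists_hasRatio_of_mem_SInvariant hR hErg (hsS n)
    (div_lt_self hsn hg1) (lt_mul_of_one_lt_right hsn hg1) hW.measurableSet_dom hW0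
  have hdom : SetRel.dom V ⊆ SetRel.dom (V ○ W) := by
    rintro x ⟨y, hxy⟩
    obtain ⟨z, hyz⟩ := (hVW hxy).2
    exact ⟨z, y, hxy, hyz⟩
  refine ⟨V ○ W, ?_, hV.comp hW, fun h0 => hV0 (measure_mono_null hdom h0),
    (hVratio.comp hV hW hWratio).weaken ?_ ?_⟩
  · rintro ⟨x, z⟩ ⟨y, hxy, hyz⟩
    obtain ⟨y', hxy'⟩ := (hVW hxy).1
    exact ⟨(hWAB hxy').1, (hWAB hyz).2⟩
  · rw [← ENNReal.ofReal_mul hγ0.le]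
    refine ENNReal.ofReal_le_ofReal ?_
    rw [← div_le_iff₀' hγ0, le_div_iff₀ hg0]
    exact (congrArg (· * g) (mul_div_assoc C m γ)).trans_le hlower
  · rw [← ENNReal.ofReal_mul (by positivity)]
    refine ENNReal.ofReal_le_ofReal ?_
    calc γ * g * (s ^ n * g) = γ * (s ^ n * g ^ 2) := by ring
      _ ≤ m := (le_div_iff₀' hγ0).1 hupper

end LocalRatios

section Comparison

theorem exists_maximal_pairwiseDisjoint_dom_cod [SFinite μ] {𝒢 : Set (SetRel X X)}
    (h𝒢 : ∀ V ∈ 𝒢, MeasurableSet V.dom) (h𝒢0 : ∀ V ∈ 𝒢, μ V.dom ≠ 0) :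
    ∃ 𝒱 ⊆ 𝒢, 𝒱.Countable ∧ 𝒱.PairwiseDisjoint SetRel.dom ∧ 𝒱.PairwiseDisjoint SetRel.cod ∧
      ∀ V ∈ 𝒢, (∀ W ∈ 𝒱, Disjoint V.dom W.dom ∧ Disjoint V.cod W.cod) → V ∈ 𝒱 := by
  obtain ⟨𝒱, h𝒱⟩ := zorn_subset
      {𝒱 | 𝒱 ⊆ 𝒢 ∧ 𝒱.PairwiseDisjoint SetRel.dom ∧ 𝒱.PairwiseDisjoint SetRel.cod} fun c hc hchain =>
    ⟨⋃₀ c, ⟨sUnion_subset fun s hs => (hc hs).1,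
      (pairwiseDisjoint_sUnion hchain.directedOn).2 fun s hs => (hc hs).2.1,
      (pairwiseDisjoint_sUnion hchain.directedOn).2 fun s hs => (hc hs).2.2⟩,
      fun s hs => subset_sUnion_of_mem hs⟩
  obtain ⟨hsub, hdom, hcod⟩ := h𝒱.prop
  have hcount : Countable 𝒱 := by
    refine countable_univ_iff.1 ((Measure.countable_meas_pos_of_disjoint_iUnion (μ := μ)
      (As := fun V : 𝒱 => SetRel.dom V.1) (fun V => h𝒢 V (hsub V.2))
      ((pairwise_subtype_iff_pairwise_set 𝒱 _).2 hdom)).mono fun V _ => ?_)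
    exact pos_iff_ne_zero.2 (h𝒢0 V (hsub V.2))
  refine ⟨𝒱, hsub, hcount, hdom, hcod, fun V hV hdisj => ?_⟩
  exact h𝒱.le_of_ge ⟨insert_subset hV hsub, hdom.insert fun W hW _ => (hdisj W hW).1,
    hcod.insert fun W hW _ => (hdisj W hW).2⟩ (subset_insert V 𝒱) (mem_insert V 𝒱)

variable [StandardBorelSpace X]

theorem exists_hasRatio_exhausting [SFinite μ] {A B : Set X} (hA : MeasurableSet A)
    (hB : MeasurableSet B) {a b : ENNReal}
    (h : ∀ A' B', MeasurableSet A' → MeasurableSet B' → μ A' ≠ 0 → μ B' ≠ 0 →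
      ∃ V ⊆ A' ×ˢ B', IsBisection R V ∧ μ (SetRel.dom V) ≠ 0 ∧ HasRatio μ μ a b V) :
    ∃ F ⊆ A ×ˢ B, IsBisection R F ∧ HasRatio μ μ a b F ∧
      (μ (A \ SetRel.dom F) = 0 ∨ μ (B \ SetRel.cod F) = 0) := by
  set 𝒢 : Set (SetRel X X) :=
    {V | V ⊆ A ×ˢ B ∧ IsBisection R V ∧ μ V.dom ≠ 0 ∧ HasRatio μ μ a b V}
  obtain ⟨𝒱, hsub, hcount, hdom, hcod, hmax⟩ := exists_maximal_pairwiseDisjoint_dom_cod (𝒢 := 𝒢)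
    (fun V hV => hV.2.1.measurableSet_dom) fun V hV => hV.2.2.1
  have := hcount.to_subtype
  replace hdom := (pairwise_subtype_iff_pairwise_set 𝒱 _).2 hdom
  replace hcod := (pairwise_subtype_iff_pairwise_set 𝒱 _).2 hcod
  have hb (V : 𝒱) : IsBisection R V.1 := (hsub V.2).2.1
  have hF := IsBisection.iUnion hb hdom hcod
  refine ⟨⋃ V : 𝒱, V.1, iUnion_subset fun V => (hsub V.2).1, hF,
    HasRatio.iUnion hb hdom hcod fun V => (hsub V.2).2.2.2, ?_⟩
  by_contra! hne
  obtain ⟨V, hVs, hV, hV0, hVratio⟩ :=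
    h _ _ (hA.diff hF.measurableSet_dom) (hB.diff hF.measurableSet_cod) hne.1 hne.2
  have hVmem : V ∈ 𝒱 := by
    refine hmax V ⟨fun p hp => ⟨(hVs hp).1.1, (hVs hp).2.1⟩, hV, hV0, hVratio⟩ fun W hW =>
      ⟨disjoint_left.2 ?_, disjoint_left.2 ?_⟩
    · rintro x ⟨y, hxy⟩ ⟨y', hxy'⟩
      exact (hVs hxy).1.2 ⟨y', mem_iUnion.2 ⟨⟨W, hW⟩, hxy'⟩⟩
    · rintro y ⟨x, hxy⟩ ⟨x', hxy'⟩
      exact (hVs hxy).2.2 ⟨x', mem_iUnion.2 ⟨⟨W, hW⟩, hxy'⟩⟩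
  obtain ⟨x, y, hxy⟩ := nonempty_of_measure_ne_zero hV0
  exact (hVs hxy).1.2 ⟨y, mem_iUnion.2 ⟨⟨V, hVmem⟩, hxy⟩⟩

theorem IsBisection.measurableSet_image (hV : IsBisection R V) {S : Set X}
    (hS : MeasurableSet S) : MeasurableSet (V.image S) := by
  have hcod : V.image S = SetRel.cod (V ∩ S ×ˢ univ) :=
    Subset.antisymm (fun y ⟨x, hx, hxy⟩ => ⟨x, hxy, hx, mem_univ y⟩)
      fun y ⟨x, hxy, hx, _⟩ => ⟨x, hx, hxy⟩
  rw [hcod]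
  exact (hV.mono (hV.measurableSet.inter (hS.prod MeasurableSet.univ))
    inter_subset_left).measurableSet_cod

theorem IsBisection.exists_eq_union_preimage_image (hF : IsBisection R V)
    (hG : IsBisection R W) {E : Set X} (hE : MeasurableSet E) :
    ∃ S, MeasurableSet S ∧ S = E ∪ W.preimage (V.image S) := by
  set φ : Set X → Set X := fun S => W.preimage (V.image S) with hφ
  have hm (n : ℕ) : MeasurableSet (φ^[n] E) := by
    induction n with
    | zero => exact hE
    | succ n ih =>
      rw [Function.iterate_succ_apply']
      exact hG.inv.measurableSet_image (hF.measurableSet_image ih)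
  refine ⟨⋃ n, φ^[n] E, MeasurableSet.iUnion hm, ?_⟩
  calc ⋃ n, φ^[n] E = E ∪ ⋃ n, φ^[n + 1] E := (sup_iSup_nat_succ fun n => φ^[n] E).symm
    _ = E ∪ φ (⋃ n, φ^[n] E) := by
      simp only [Function.iterate_succ_apply', hφ, SetRel.image_iUnion, SetRel.preimage_iUnion]

theorem IsBisection.exists_cantorBernstein {F G : SetRel X X} (hF : IsBisection R F)
    (hG : IsBisection R G) {A B : Set X} (hA : MeasurableSet A) (hFs : F ⊆ A ×ˢ B)
    (hGs : G ⊆ A ×ˢ B) {a b : ENNReal} (hFratio : HasRatio μ μ a b F)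
    (hGratio : HasRatio μ μ a b G) (hF0 : μ (A \ F.dom) = 0) (hG0 : μ (B \ G.cod) = 0) :
    ∃ H ⊆ A ×ˢ B, IsBisection R H ∧ HasRatio μ μ a b H ∧
      μ (A \ SetRel.dom H) = 0 ∧ μ (B \ SetRel.cod H) = 0 := by
  obtain ⟨S, hSm, hS⟩ :=
    hF.exists_eq_union_preimage_image hG (hA.diff hG.measurableSet_dom)
  set F' : SetRel X X := F ∩ S ×ˢ univ
  set G' : SetRel X X := G ∩ Sᶜ ×ˢ univ
  have hF' : IsBisection R F' :=
    hF.mono (hF.measurableSet.inter (hSm.prod MeasurableSet.univ)) inter_subset_left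
  have hG' : IsBisection R G' :=
    hG.mono (hG.measurableSet.inter (hSm.compl.prod MeasurableSet.univ)) inter_subset_left
  have hdom : Disjoint F'.dom G'.dom := disjoint_left.2 fun x ⟨_, hF⟩ ⟨_, hG⟩ => hG.2.1 hF.2.1
  have hcod : Disjoint F'.cod G'.cod := by
    refine disjoint_left.2 fun y ⟨x, hxy, hx, _⟩ ⟨x', hx'y, hx', _⟩ => hx' ?_
    rw [hS]
    exact Or.inr ⟨y, ⟨x, hx, hxy⟩, hx'y⟩
  refine ⟨F' ∪ G', union_subset (inter_subset_left.trans hFs) (inter_subset_left.trans hGs),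
    hF'.union hG' hdom hcod, .union hF' hG' hdom hcod (hFratio.mono inter_subset_left)
      (hGratio.mono inter_subset_left),
    measure_mono_null ?_ hF0, measure_mono_null ?_ hG0⟩
  · rintro x ⟨hxA, hx⟩
    refine ⟨hxA, fun ⟨y, hxy⟩ => hx ?_⟩
    by_cases hxS : x ∈ S
    · exact ⟨y, Or.inl ⟨hxy, hxS, mem_univ y⟩⟩
    · obtain ⟨z, hxz⟩ : x ∈ G.dom := by
        by_contra h
        exact hxS (hS ▸ Or.inl ⟨hxA, h⟩)
      exact ⟨z, Or.inr ⟨hxz, hxS, mem_univ z⟩⟩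
  · rintro y ⟨hyB, hy⟩
    refine ⟨hyB, fun ⟨x, hxy⟩ => hy ?_⟩
    by_cases hxS : x ∈ S
    · rw [hS] at hxS
      obtain ⟨-, hxG⟩ | ⟨y', ⟨z, hz, hzy'⟩, hxy'⟩ := hxS
      · exact absurd ⟨y, hxy⟩ hxG
      · obtain rfl := hG.cod_unique hxy hxy'
        exact ⟨z, Or.inl ⟨hzy', hz, mem_univ y⟩⟩
    · exact ⟨x, Or.inr ⟨hxy, hxS, mem_univ y⟩⟩

variable [IsFiniteMeasure μ] {C : ℝ} {A B : Set X}

theorem HasLocalRatios.exists_hasRatio_of_source (h : HasLocalRatios R μ C) (hA : MeasurableSet A)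
    (hB : MeasurableSet B) (hA0 : μ A ≠ 0) (hB0 : μ B ≠ 0) :
    ∃ F ⊆ A ×ˢ B, IsBisection R F ∧ μ (A \ SetRel.dom F) = 0 ∧
      HasRatio μ μ (ENNReal.ofReal (C * (μ.real B / μ.real A)))
        (ENNReal.ofReal (μ.real B / μ.real A)) F := by
  have hAr : 0 < μ.real A := ENNReal.toReal_pos hA0 (measure_ne_top _ _)
  have hBr : 0 < μ.real B := ENNReal.toReal_pos hB0 (measure_ne_top _ _)
  obtain ⟨F, hFs, hF, hratio, hnull⟩ :=
    exists_hasRatio_exhausting hA hB (h (μ.real B / μ.real A) (by positivity))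
  refine ⟨F, hFs, hF, hnull.elim id fun hB' => ?_, hratio⟩
  have hFA : SetRel.dom F ⊆ A := fun x ⟨_, hxy⟩ => (hFs hxy).1
  have hmass : μ B ≤ ENNReal.ofReal (μ.real B / μ.real A) * μ (SetRel.dom F) :=
    calc μ B ≤ μ (B ∩ SetRel.cod F) + μ (B \ SetRel.cod F) := measure_le_inter_add_sdiff _ _ _
      _ ≤ μ (SetRel.cod F) := by
        rw [hB', add_zero]
        exact measure_mono inter_subset_right
      _ ≤ _ := (hratio F Subset.rfl hF.measurableSet).2
  have hmassReal : μ.real B ≤ μ.real B / μ.real A * μ.real (SetRel.dom F) := by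
    have := ENNReal.toReal_mono
      (ENNReal.mul_ne_top ENNReal.ofReal_ne_top (measure_ne_top _ _)) hmass
    rwa [ENNReal.toReal_mul, ENNReal.toReal_ofReal (by positivity)] at this
  rw [div_mul_eq_mul_div, le_div_iff₀ hAr] at hmassReal
  rw [measure_sdiff hFA hF.measurableSet_dom.nullMeasurableSet (measure_ne_top _ _)]
  exact tsub_eq_zero_of_le ((ENNReal.toReal_le_toReal (measure_ne_top _ _)
    (measure_ne_top _ _)).1 (le_of_mul_le_mul_left hmassReal hBr))

theorem HasLocalRatios.exists_hasRatio (h : HasLocalRatios R μ C) (hC : 0 < C) (hC1 : C ≤ 1)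
    (hA : MeasurableSet A) (hB : MeasurableSet B) (hA0 : μ A ≠ 0) (hB0 : μ B ≠ 0) :
    ∃ H ⊆ A ×ˢ B, IsBisection R H ∧
      HasRatio μ μ (ENNReal.ofReal (C * (μ.real B / μ.real A)))
        (ENNReal.ofReal (C⁻¹ * (μ.real B / μ.real A))) H ∧
      μ (A \ SetRel.dom H) = 0 ∧ μ (B \ SetRel.cod H) = 0 := by
  have hAr : 0 < μ.real A := ENNReal.toReal_pos hA0 (measure_ne_top _ _)
  have hBr : 0 < μ.real B := ENNReal.toReal_pos hB0 (measure_ne_top _ _)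
  have hm : 0 < μ.real B / μ.real A := by positivity
  obtain ⟨F, hFs, hF, hF0, hFratio⟩ := h.exists_hasRatio_of_source hA hB hA0 hB0
  obtain ⟨G, hGs, hG, hG0, hGratio⟩ := h.exists_hasRatio_of_source hB hA hB0 hA0
  refine hF.exists_cantorBernstein hG.inv hA hFs (fun p hp => (hGs hp).symm)
    (hFratio.weaken le_rfl (ENNReal.ofReal_le_ofReal ?_)) ((hGratio.inv (ENNReal.ofReal_pos.2
      (by positivity)).ne' ENNReal.ofReal_ne_top).weaken ?_ ?_) hF0 hG0
  · exact le_mul_of_one_le_left hm.le ((one_le_inv₀ hC).2 hC1)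
  · rw [← ENNReal.ofReal_inv_of_pos (by positivity), inv_div]
    exact ENNReal.ofReal_le_ofReal (mul_le_of_le_one_left hm.le hC1)
  · rw [← ENNReal.ofReal_inv_of_pos (by positivity), mul_inv, inv_div]

end Comparison

section PartialIsomorphisms

open Classical in
/-- The partial map with graph `W`, extended by the identity outside the domain of `W`. -/
noncomputable def partialMap (W : SetRel X X) (x : X) : X :=
  if h : ∃ y, (x, y) ∈ W then h.choose else x

namespace IsBisection

theorem partialMap_eq (hW : IsBisection R W) {x y : X} (h : (x, y) ∈ W) :
    partialMap W x = y := by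
  have hx : ∃ y, (x, y) ∈ W := ⟨y, h⟩
  rw [partialMap, dif_pos hx]
  exact hW.cod_unique hx.choose_spec h

/-- The partial bijection of `X` with graph `W`. -/
noncomputable def toPartialEquiv (hW : IsBisection R W) : PartialEquiv X X where
  toFun := partialMap W
  invFun := partialMap W.inv
  source := W.dom
  target := W.cod
  map_source' := fun x ⟨y, h⟩ => ⟨x, by rwa [hW.partialMap_eq h]⟩
  map_target' := fun y ⟨x, h⟩ => ⟨y, by rwa [hW.inv.partialMap_eq h]⟩
  left_inv' := fun x ⟨y, h⟩ => by rw [hW.partialMap_eq h, hW.inv.partialMap_eq h]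
  right_inv' := fun y ⟨x, h⟩ => by rw [hW.inv.partialMap_eq h, hW.partialMap_eq h]

theorem toPartialEquiv_apply (hW : IsBisection R W) {x y : X} (h : (x, y) ∈ W) :
    hW.toPartialEquiv x = y :=
  hW.partialMap_eq h

theorem image_toPartialEquiv (hW : IsBisection R W) {N : Set X} (hN : N ⊆ W.dom) :
    hW.toPartialEquiv '' N = SetRel.cod (W ∩ N ×ˢ univ) := by
  refine Subset.antisymm ?_ ?_
  · rintro _ ⟨x, hx, rfl⟩
    obtain ⟨y, h⟩ := hN hx
    exact ⟨x, by rwa [hW.toPartialEquiv_apply h], hx, mem_univ _⟩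
  · rintro y ⟨x, h, hx, -⟩
    exact ⟨x, hx, hW.toPartialEquiv_apply h⟩

variable [StandardBorelSpace X]

theorem measurable_domRestrict_partialMap (hW : IsBisection R W) :
    Measurable (W.dom.domRestrict (partialMap W)) := by
  intro E hE
  have hdom : MeasurableSet (SetRel.dom (W ∩ Prod.snd ⁻¹' E)) :=
    (hW.mono (hW.measurableSet.inter (measurable_snd hE)) inter_subset_left).measurableSet_dom
  convert measurable_subtype_coe hdom using 1
  ext ⟨x, y, h⟩
  simp only [mem_preimage, domRestrict_apply, hW.partialMap_eq h]
  refine ⟨fun hy => ⟨y, h, hy⟩, fun ⟨z, hz, hzE⟩ => ?_⟩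
  rwa [hW.cod_unique h hz]

theorem toPartialEquiv_mem_fullPseudogroup (hR : IsNonsingular R μ) (hW : IsBisection R W) :
    hW.toPartialEquiv ∈ fullPseudogroup R μ := by
  refine ⟨⟨hW.measurableSet_dom, hW.measurableSet_cod, hW.measurable_domRestrict_partialMap,
    hW.inv.measurable_domRestrict_partialMap, fun N hN => ?_⟩, ae_of_all _ fun x ⟨y, h⟩ => ?_⟩
  · have hdom : SetRel.dom (W ∩ N ×ˢ univ) = N :=
      Subset.antisymm (fun x ⟨_, _, hx, _⟩ => hx) fun x hx =>
        let ⟨y, h⟩ := hN hx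
        ⟨y, h, hx, mem_univ y⟩
    rw [hW.image_toPartialEquiv hN, ← hR.measure_dom_eq_zero_iff
      (inter_subset_left.trans hW.subset_graph), hdom]
  · rw [hW.toPartialEquiv_apply h]
    exact hW.rel h

theorem compMeasure_apply (hW : IsBisection R W) {E : Set X} (hE : MeasurableSet E) :
    compMeasure μ hW.toPartialEquiv E = μ (SetRel.cod (W ∩ E ×ˢ univ)) := by
  have hae : AEMeasurable (partialMap W.inv) (μ.restrict W.cod) :=
    aemeasurable_restrict_of_measurable_subtype hW.measurableSet_cod
      hW.inv.measurable_domRestrict_partialMap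
  calc compMeasure μ hW.toPartialEquiv E = μ (partialMap W.inv ⁻¹' E ∩ W.cod) :=
        (Measure.map_apply_of_aemeasurable hae hE).trans
          (Measure.restrict_apply' hW.measurableSet_cod)
    _ = μ (SetRel.cod (W ∩ E ×ˢ univ)) := by
      congr 1
      refine Subset.antisymm ?_ ?_
      · rintro y ⟨hy, x, h⟩
        rw [mem_preimage, hW.inv.partialMap_eq h] at hy
        exact ⟨x, h, hy, mem_univ y⟩
      · rintro y ⟨x, h, hx, -⟩
        refine ⟨?_, x, h⟩
        rwa [mem_preimage, hW.inv.partialMap_eq h]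

theorem compMeasure_mem_Icc (hW : IsBisection R W) {a b : ENNReal} (h : HasRatio μ μ a b W)
    {E : Set X} (hE : MeasurableSet E) :
    compMeasure μ hW.toPartialEquiv E ∈ Icc (a * μ (W.dom ∩ E)) (b * μ (W.dom ∩ E)) := by
  have hdom : SetRel.dom (W ∩ E ×ˢ univ) = W.dom ∩ E :=
    Subset.antisymm (fun x ⟨y, h, hx, _⟩ => ⟨⟨y, h⟩, hx⟩)
      fun x ⟨⟨y, h⟩, hx⟩ => ⟨y, h, hx, mem_univ y⟩
  rw [hW.compMeasure_apply hE, ← hdom]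
  exact h _ inter_subset_left (hW.measurableSet.inter (hE.prod MeasurableSet.univ))

variable [IsFiniteMeasure μ] {a b : ℝ}

theorem ae_derivative_mem_Icc (hW : IsBisection R W) (hb : 0 ≤ b)
    (h : HasRatio μ μ (ENNReal.ofReal a) (ENNReal.ofReal b) W) :
    ∀ᵐ x ∂μ, x ∈ W.dom → derivative μ hW.toPartialEquiv x ∈ Icc a b := by
  set ρ := compMeasure μ hW.toPartialEquiv with hρ
  have hfin : IsFiniteMeasure ρ := by
    rw [hρ, compMeasure]
    infer_instance
  have hle {E : Set X} (hE : MeasurableSet E) : ρ E ≤ ENNReal.ofReal b * μ E :=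
    (hW.compMeasure_mem_Icc h hE).2.trans (mul_le_mul_right (measure_mono inter_subset_right) _)
  have hac : ρ ≪ μ := Measure.AbsolutelyContinuous.mk fun E hE h0 => by
    simpa only [h0, mul_zero, nonpos_iff_eq_zero] using hle hE
  have hlower : W.dom.indicator (fun _ => ENNReal.ofReal a) ≤ᵐ[μ] ρ.rnDeriv μ := by
    refine ae_le_of_forall_setLIntegral_le_of_sigmaFinite
      (measurable_const.indicator hW.measurableSet_dom) fun E hE _ => ?_
    rw [Measure.setLIntegral_rnDeriv hac, lintegral_indicator hW.measurableSet_dom,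
      setLIntegral_const, Measure.restrict_apply hW.measurableSet_dom]
    exact (hW.compMeasure_mem_Icc h hE).1
  have hupper : ρ.rnDeriv μ ≤ᵐ[μ] fun _ => ENNReal.ofReal b := by
    refine ae_le_of_forall_setLIntegral_le_of_sigmaFinite (Measure.measurable_rnDeriv _ _)
      fun E hE _ => ?_
    rw [Measure.setLIntegral_rnDeriv hac, setLIntegral_const]
    exact hle hE
  filter_upwards [hlower, hupper] with x hxa hxb hx
  rw [indicator_of_mem hx] at hxa
  exact ⟨(ENNReal.ofReal_le_iff_le_toReal (hxb.trans_lt ENNReal.ofReal_lt_top).ne).1 hxa,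
    ENNReal.toReal_le_of_le_ofReal hb hxb⟩

theorem isMuBounded (hW : IsBisection R W) (ha : 0 < a) (hb : 0 ≤ b)
    (h : HasRatio μ μ (ENNReal.ofReal a) (ENNReal.ofReal b) W) :
    IsMuBounded μ hW.toPartialEquiv := by
  refine ⟨max |Real.log a| |Real.log b|, ?_⟩
  filter_upwards [hW.ae_derivative_mem_Icc hb h] with x hx hxW
  obtain ⟨hxa, hxb⟩ := hx hxW
  exact abs_le_max_abs_abs (Real.log_le_log ha hxa) (Real.log_le_log (ha.trans_le hxa) hxb)

end IsBisection

theorem HasLocalRatios.exists_mem_fullPseudogroup [StandardBorelSpace X] [IsFiniteMeasure μ]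
    {C : ℝ} {A B : Set X} (h : HasLocalRatios R μ C) (hR : IsNonsingular R μ) (hC : 0 < C)
    (hC1 : C ≤ 1) (hA : MeasurableSet A) (hB : MeasurableSet B) (hA0 : μ A ≠ 0) (hB0 : μ B ≠ 0) :
    ∃ θ ∈ fullPseudogroup R μ, θ.source =ᵐ[μ] A ∧ θ.target =ᵐ[μ] B ∧ IsMuBounded μ θ ∧
      ∀ᵐ x ∂μ, x ∈ A → C * (μ.real B / μ.real A) ≤ derivative μ θ x ∧
        derivative μ θ x ≤ C⁻¹ * (μ.real B / μ.real A) := by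
  have hAr : 0 < μ.real A := ENNReal.toReal_pos hA0 (measure_ne_top _ _)
  have hBr : 0 < μ.real B := ENNReal.toReal_pos hB0 (measure_ne_top _ _)
  obtain ⟨H, hHs, hH, hratio, hdom, hcod⟩ := h.exists_hasRatio hC hC1 hA hB hA0 hB0
  have hHA : SetRel.dom H ⊆ A := fun x ⟨_, hxy⟩ => (hHs hxy).1
  have hHB : SetRel.cod H ⊆ B := fun y ⟨_, hxy⟩ => (hHs hxy).2
  have hsource : SetRel.dom H =ᵐ[μ] A := hHA.eventuallyLE.antisymm (ae_le_set.2 hdom)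
  refine ⟨hH.toPartialEquiv, hH.toPartialEquiv_mem_fullPseudogroup hR, hsource,
    hHB.eventuallyLE.antisymm (ae_le_set.2 hcod),
    hH.isMuBounded (by positivity) (by positivity) hratio, ?_⟩
  filter_upwards [hH.ae_derivative_mem_Icc (by positivity) hratio, hsource.mem_iff]
    with x hx hxA hxmem using hx (hxA.2 hxmem)

end PartialIsomorphisms

section Density

/-- The part of the graph of a partial bijection that lies in `R`. For an element of `[[R]]` this
is the whole graph up to null sets. -/
def graphIn (R : Setoid X) (θ : PartialEquiv X X) : SetRel X X :=
  graph R ∩ {p | p.1 ∈ θ.source ∧ θ p.1 = p.2}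

theorem measure_sdiff_of_ae_eq_univ {s : Set X} (t : Set X) (hs : s =ᵐ[μ] univ) :
    μ (s \ t) = μ tᶜ := by
  rw [compl_eq_univ_sdiff]
  exact measure_congr (hs.diff ae_eq_rfl)

variable {θ : PartialEquiv X X}

theorem dom_graphIn_ae_eq (hθ : θ ∈ fullPseudogroup R μ) :
    SetRel.dom (graphIn R θ) =ᵐ[μ] θ.source := by
  have hsub : SetRel.dom (graphIn R θ) ⊆ θ.source := fun x ⟨_, _, hx, _⟩ => hx
  refine hsub.eventuallyLE.antisymm ?_
  filter_upwards [hθ.2] with x hx hxs using ⟨θ x, hx hxs, hxs, rfl⟩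

theorem cod_graphIn_ae_eq (hθ : θ ∈ fullPseudogroup R μ) :
    SetRel.cod (graphIn R θ) =ᵐ[μ] θ.target := by
  have hsub : SetRel.cod (graphIn R θ) ⊆ θ.target := by
    rintro y ⟨x, -, hx, (rfl : θ x = y)⟩
    exact θ.map_source hx
  have hnull : μ (θ '' (θ.source \ SetRel.dom (graphIn R θ))) = 0 :=
    (hθ.1.null_iff _ sdiff_subset).2 (ae_le_set.1 (dom_graphIn_ae_eq hθ).symm.le)
  refine hsub.eventuallyLE.antisymm (ae_le_set.2 (measure_mono_null ?_ hnull))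
  rintro y ⟨hyt, hy⟩
  refine ⟨θ.symm y, ⟨θ.map_target hyt, ?_⟩, θ.right_inv hyt⟩
  rintro ⟨z, hyz, hys, hz⟩
  rw [θ.right_inv hyt] at hz
  exact hy ⟨θ.symm y, hz ▸ hyz, hys, θ.right_inv hyt⟩

variable [StandardBorelSpace X]

theorem isBisection_graphIn (hR : IsNonsingular R μ) (hθ : IsPartialIso μ θ) :
    IsBisection R (graphIn R θ) where
  measurableSet := by
    have := hθ.measurableSet_source.standardBorel
    have hrange : {p : X × X | p.1 ∈ θ.source ∧ θ p.1 = p.2} =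
        (fun x : θ.source => ((x : X), θ x)) '' univ := by
      ext ⟨x, y⟩
      refine ⟨fun ⟨hx, hxy⟩ => ⟨⟨x, hx⟩, mem_univ _, Prod.ext rfl hxy⟩, fun ⟨z, _, hz⟩ => ?_⟩
      obtain ⟨rfl, hy⟩ := Prod.ext_iff.1 hz
      exact ⟨z.2, hy⟩
    rw [graphIn, hrange]
    exact hR.measurableSet_graph.inter (MeasurableSet.univ.image_of_measurable_injOn
      (measurable_subtype_coe.prodMk hθ.measurable_toFun)
      fun x _ y _ h => Subtype.ext (congrArg Prod.fst h))
  subset_graph := inter_subset_left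
  injOn_fst := by
    rintro p ⟨-, -, hp⟩ q ⟨-, -, hq⟩ h
    exact Prod.ext h (hp.symm.trans ((congrArg θ h).trans hq))
  injOn_snd := by
    rintro p ⟨-, hps, hp⟩ q ⟨-, hqs, hq⟩ h
    exact Prod.ext (θ.injOn hps hqs (hp.trans (h.trans hq.symm))) h

namespace IsBisection

theorem measure_dom_setOf_modulus_nonpos [SigmaFinite μ] (hR : IsNonsingular R μ)
    (hW : IsBisection R W) : μ (SetRel.dom (W ∩ {p | ¬ 0 < modulus R μ p})) = 0 := by
  have hbad : MeasurableSet (W ∩ {p | ¬ 0 < modulus R μ p}) :=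
    hW.measurableSet.inter (measurableSet_lt measurable_const (measurable_modulus R μ)).compl
  rw [← hR.rightMeasure_eq_zero_iff hbad (inter_subset_left.trans hW.subset_graph)]
  exact measure_mono_null inter_subset_right (ae_iff.1 hR.ae_modulus_pos)

variable [IsFiniteMeasure μ]

theorem exists_hasRatio_subset (hR : IsNonsingular R μ) (hW : IsBisection R W) {ε : ENNReal}
    (hε : 0 < ε) :
    ∃ V ⊆ W, MeasurableSet V ∧ μ (W.dom \ SetRel.dom V) < ε ∧ ∃ a b : ℝ, 0 < a ∧ 0 < b ∧
      HasRatio μ μ (ENNReal.ofReal a) (ENNReal.ofReal b) V := by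
  set U : ℕ → SetRel X X := fun n => W ∩ modulus R μ ⁻¹' Icc ((n : ℝ) + 1)⁻¹ ((n : ℝ) + 1)
  have hU (n : ℕ) : IsBisection R (U n) :=
    hW.mono (hW.measurableSet.inter (measurable_modulus R μ measurableSet_Icc)) inter_subset_left
  have hmono : Monotone U := fun i j hij => by
    have : (i : ℝ) + 1 ≤ (j : ℝ) + 1 := by gcongr
    exact inter_subset_inter_right W (preimage_mono
      (Icc_subset_Icc (inv_anti₀ (by positivity) this) this))
  have hlim : μ (⋂ n, W.dom \ (U n).dom) = 0 := by
    refine measure_mono_null ?_ (hW.measure_dom_setOf_modulus_nonpos hR)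
    intro x hx
    obtain ⟨⟨y, hxy⟩, -⟩ := mem_iInter.1 hx 0
    refine ⟨y, hxy, fun hpos => ?_⟩
    obtain ⟨n, hn⟩ := exists_nat_ge (max (modulus R μ (x, y)) (modulus R μ (x, y))⁻¹)
    obtain ⟨hn₁, hn₂⟩ := max_le_iff.1 (hn.trans (lt_add_one _).le)
    exact (mem_iInter.1 hx n).2 ⟨y, hxy, inv_le_of_inv_le₀ hpos hn₂, hn₁⟩
  have htend := tendsto_measure_iInter_atTop (μ := μ) (s := fun n => W.dom \ (U n).dom)
    (fun n => (hW.measurableSet_dom.diff (hU n).measurableSet_dom).nullMeasurableSet)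
    (fun i j hij => sdiff_subset_sdiff_right (SetRel.dom_mono (hmono hij)))
    ⟨0, measure_ne_top _ _⟩
  rw [hlim] at htend
  obtain ⟨n, hn⟩ := (htend.eventually_lt_const hε).exists
  have hratio : HasRatio μ μ (ENNReal.ofReal ((n : ℝ) + 1)⁻¹) (ENNReal.ofReal ((n : ℝ) + 1))
    (U n).inv := .of_modulus hR (hU n) fun p hp => hp.2
  refine ⟨U n, inter_subset_left, (hU n).measurableSet, hn, ((n : ℝ) + 1)⁻¹, (n : ℝ) + 1,
    by positivity, by positivity, ?_⟩
  simpa only [ENNReal.ofReal_inv_of_pos (Nat.cast_add_one_pos (α := ℝ) n), inv_inv,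
    SetRel.inv_inv] using
    hratio.inv (ENNReal.ofReal_pos.2 (by positivity)).ne' ENNReal.ofReal_ne_top

end IsBisection

variable {C : ℝ}

theorem HasLocalRatios.exists_hasRatio_of_null_iff [IsFiniteMeasure μ] (hloc : HasLocalRatios R μ C)
    (hC : 0 < C) (hC1 : C ≤ 1) {A B : Set X} (hA : MeasurableSet A) (hB : MeasurableSet B)
    (hAB : μ A = 0 ↔ μ B = 0) :
    ∃ H ⊆ A ×ˢ B, IsBisection R H ∧ μ (A \ SetRel.dom H) = 0 ∧ μ (B \ SetRel.cod H) = 0 ∧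
      ∃ a b : ℝ, 0 < a ∧ 0 < b ∧ HasRatio μ μ (ENNReal.ofReal a) (ENNReal.ofReal b) H := by
  by_cases hA0 : μ A = 0
  · refine ⟨∅, empty_subset _, ⟨.empty, empty_subset _, injOn_empty _, injOn_empty _⟩,
      measure_mono_null sdiff_subset hA0, measure_mono_null sdiff_subset (hAB.1 hA0), 1, 1,
      one_pos, one_pos, fun U hU _ => ?_⟩
    obtain rfl := subset_empty_iff.1 hU
    simp only [SetRel.dom_empty, SetRel.cod_empty, measure_empty, mul_zero, le_refl, and_self]
  · have hB0 : μ B ≠ 0 := fun h => hA0 (hAB.2 h)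
    have hAr : 0 < μ.real A := ENNReal.toReal_pos hA0 (measure_ne_top _ _)
    have hBr : 0 < μ.real B := ENNReal.toReal_pos hB0 (measure_ne_top _ _)
    obtain ⟨H, hHs, hH, hratio, hdom, hcod⟩ := hloc.exists_hasRatio hC hC1 hA hB hA0 hB0
    exact ⟨H, hHs, hH, hdom, hcod, _, _, by positivity, by positivity, hratio⟩

theorem HasLocalRatios.exists_isBisection_superset [IsFiniteMeasure μ] (hloc : HasLocalRatios R μ C)
    (hC : 0 < C) (hC1 : C ≤ 1) (hV : IsBisection R V) {a b : ℝ} (ha : 0 < a)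
    (hratio : HasRatio μ μ (ENNReal.ofReal a) (ENNReal.ofReal b) V)
    (hnull : μ V.domᶜ = 0 ↔ μ V.codᶜ = 0) :
    ∃ U ⊇ V, IsBisection R U ∧ SetRel.dom U =ᵐ[μ] univ ∧ SetRel.cod U =ᵐ[μ] univ ∧
      ∃ a b : ℝ, 0 < a ∧ 0 < b ∧ HasRatio μ μ (ENNReal.ofReal a) (ENNReal.ofReal b) U := by
  obtain ⟨H, hHs, hH, hHdom, hHcod, a', b', ha', hb', hratio'⟩ :=
    hloc.exists_hasRatio_of_null_iff hC hC1 hV.measurableSet_dom.compl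
      hV.measurableSet_cod.compl hnull
  have hdom : Disjoint V.dom (SetRel.dom H) :=
    disjoint_left.2 fun x hx ⟨_, hxy⟩ => (hHs hxy).1 hx
  have hcod : Disjoint V.cod (SetRel.cod H) :=
    disjoint_left.2 fun y hy ⟨_, hxy⟩ => (hHs hxy).2 hy
  refine ⟨V ∪ H, subset_union_left, hV.union hH hdom hcod, ?_, ?_, min a a', max b b',
    lt_min ha ha', lt_max_of_lt_right hb',
    .union hV hH hdom hcod
      (hratio.weaken (ENNReal.ofReal_le_ofReal (min_le_left _ _))
        (ENNReal.ofReal_le_ofReal (le_max_left _ _)))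
      (hratio'.weaken (ENNReal.ofReal_le_ofReal (min_le_right _ _))
        (ENNReal.ofReal_le_ofReal (le_max_right _ _)))⟩
  · rwa [ae_eq_univ, dom_union, compl_union, ← sdiff_eq]
  · rwa [ae_eq_univ, cod_union, compl_union, ← sdiff_eq]

theorem HasLocalRatios.dense_isMuBounded [IsProbabilityMeasure μ] (hloc : HasLocalRatios R μ C)
    (hR : IsNonsingular R μ) (hC : 0 < C) (hC1 : C ≤ 1) :
    Dense {θ : FullGroup R μ | IsMuBounded μ θ.1} := by
  rw [Metric.dense_iff]
  rintro ⟨θ, hθ, hs, ht⟩ r hr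
  have hW : IsBisection R (graphIn R θ) := isBisection_graphIn hR hθ.1
  obtain ⟨V, hVW, hVm, hVr, a, b, ha, -, hratio⟩ :=
    hW.exists_hasRatio_subset hR (ENNReal.ofReal_pos.2 hr)
  have hVdom := measure_sdiff_of_ae_eq_univ (SetRel.dom V) ((dom_graphIn_ae_eq hθ).trans hs)
  have hVcod := measure_sdiff_of_ae_eq_univ (SetRel.cod V) ((cod_graphIn_ae_eq hθ).trans ht)
  have hnull : μ (SetRel.dom V)ᶜ = 0 ↔ μ (SetRel.cod V)ᶜ = 0 := by
    rw [← hVdom, ← hVcod, ← hW.dom_sdiff hVW, ← hW.cod_sdiff hVW]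
    exact hR.measure_dom_eq_zero_iff (sdiff_subset.trans hW.subset_graph)
  obtain ⟨U, hVU, hU, hUdom, hUcod, a', b', ha', hb', hUratio⟩ :=
    hloc.exists_isBisection_superset hC hC1 (hW.mono hVm hVW) ha hratio hnull
  refine ⟨⟨hU.toPartialEquiv, hU.toPartialEquiv_mem_fullPseudogroup hR, hUdom, hUcod⟩, ?_,
    hU.isMuBounded ha' hb'.le hUratio⟩
  change μ.real {x | hU.toPartialEquiv x ≠ θ x} < r
  have hdiff : {x | hU.toPartialEquiv x ≠ θ x} ⊆ (SetRel.dom V)ᶜ := by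
    rintro x hx ⟨y, hxy⟩
    exact hx ((hU.toPartialEquiv_apply (hVU hxy)).trans (hVW hxy).2.2.symm)
  rw [hVdom] at hVr
  exact (measureReal_mono hdiff).trans_lt (ENNReal.toReal_lt_of_lt_ofReal hVr)

end Density

end NonsingularRelation

theorem mainTheorem7 {X : Type*} [MeasurableSpace X] [StandardBorelSpace X]
    (μ : MeasureTheory.Measure X) [MeasureTheory.IsProbabilityMeasure μ] (R : Setoid X)
    (hR : NonsingularRelation.IsNonsingular R μ)
    (hErg : NonsingularRelation.IsErgodic R μ)
    (l : ℝ) (hType : NonsingularRelation.IsTypeIIIParam R μ l) :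
    (∀ A B : Set X, MeasurableSet A → MeasurableSet B → μ A ≠ 0 → μ B ≠ 0 →
      (∃ θ ∈ NonsingularRelation.fullPseudogroup R μ,
        θ.source =ᵐ[μ] A ∧ θ.target =ᵐ[μ] B ∧ NonsingularRelation.IsMuBounded μ θ) ∧
      ∀ C : ℝ, 0 < C → C < l →
        ∃ θ ∈ NonsingularRelation.fullPseudogroup R μ,
          θ.source =ᵐ[μ] A ∧ θ.target =ᵐ[μ] B ∧ NonsingularRelation.IsMuBounded μ θ ∧
          ∀ᵐ x ∂μ, x ∈ A →
            C * (μ.real B / μ.real A) ≤ NonsingularRelation.derivative μ θ x ∧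
            NonsingularRelation.derivative μ θ x ≤ C⁻¹ * (μ.real B / μ.real A)) ∧
    Dense {θ : NonsingularRelation.FullGroup R μ | NonsingularRelation.IsMuBounded μ θ.1} := by
  have hl : 0 < l := by
    rcases hType.2 with ⟨hl, -⟩ | ⟨rfl, -⟩
    exacts [hl, one_pos]
  have hloc (C : ℝ) (hC : 0 < C) (hCl : C < l) :
      C ≤ 1 ∧ NonsingularRelation.HasLocalRatios R μ C := by
    obtain ⟨s, hCs, hs1, hsS⟩ := hType.exists_zpow_mem_SInvariant hC hCl
    exact ⟨(hCs.trans hs1).le, hErg.hasLocalRatios hR hC hCs hs1 hsS⟩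
  obtain ⟨hl2, hloc2⟩ := hloc (l / 2) (half_pos hl) (half_lt_self hl)
  refine ⟨fun A B hA hB hA0 hB0 => ⟨?_, fun C hC hCl => ?_⟩,
    hloc2.dense_isMuBounded hR (half_pos hl) hl2⟩
  · obtain ⟨θ, hθ, hs, ht, hbdd, -⟩ :=
      hloc2.exists_mem_fullPseudogroup hR (half_pos hl) hl2 hA hB hA0 hB0
    exact ⟨θ, hθ, hs, ht, hbdd⟩
  · obtain ⟨hC1, hCloc⟩ := hloc C hC hCl
    exact hCloc.exists_mem_fullPseudogroup hR hC hC1 hA hB hA0 hB0
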